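/- A *hoop* is an algebra $(A,\otimes,\to,1)$ such that $(A,\otimes,1)$ is a commutative monoid and $x\to x=1$, $x\otimes(x\to y)=y\otimes(y\to x)$, $x\to(y\to z)=(x\otimes y)\to z$ for all $x,y,z$; it is partially ordered by $x\le y\iff x\to y=1$, with meet $x\wedge y=x\otimes(x\to y)$. A *BL-algebra* is a hoop $L$ with a least element $0$ such that $(x\to y)\to z\le((y\to x)\to z)\to z$ for all $x,y,z\in L$; it is a *BL-chain* if $\le$ is a linear order. In a BL-algebra put $\bar x=x\to 0$ and $x+y=(\bar x\to y)\wedge(\bar y\to x)$; this operation is commutative and associative with identity $0$. A BL-chain is *of cancellative type* if $x+y=x+z$ and $x\otimes y=x\otimes z$ imply $y=z$; a BL-algebra is *of cancellative type* if it is a subdirect product of BL-chains of cancellative type. A *good sequence* in a BL-algebra $L$ is a sequence $\mathbf a=(a_1,a_2,\dots)$ in $L$ with $a_i+a_{i+1}=a_i$ for all $i\geq 1$ and $a_r=0$ for all large $r$. The set $M_L$ of good sequences is ordered componentwise and is closed under the addition $(\mathbf a+\mathbf b)_i=a_i+(a_{i-1}\otimes b_1)+\dots+(a_1\otimes b_{i-1})+b_i$;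 let $(0)=(0,0,\dots)$. Sums of three good sequences are bracketed to the left, $\mathbf a+\mathbf b+\mathbf c=(\mathbf a+\mathbf b)+\mathbf c$. For $\mathbf a,\mathbf b,\mathbf c,\mathbf d\in M_L$ let $(\mathbf a,\mathbf b)\sim(\mathbf c,\mathbf d)$ if there is $\mathbf k\in M_L$ with $\mathbf a+\mathbf d+\mathbf k=\mathbf b+\mathbf c+\mathbf k$. Let $G_L=(M_L\times M_L)/{\sim}$, with the class of $(\mathbf a,\mathbf b)$ written $[\mathbf a,\mathbf b]$, with zero $[(0),(0)]$ and $$[\mathbf a,\mathbf b]+[\mathbf c,\mathbf d]=[\mathbf a+\mathbf c,\mathbf b+\mathbf d],\qquad -[\mathbf a,\mathbf b]=[\mathbf b,\mathbf a],$$ $$[\mathbf a,\mathbf b]\preceq[\mathbf c,\mathbf d]\iff\text{there is }\mathbf k\in M_L\text{ with }\mathbf a+\mathbf d+\mathbf k\le\mathbf b+\mathbf c+\mathbf k .$$ **Lemma.** Let $L$ be a BL-algebra. 1. If $L$ is a BL-chain, then $\sim$ is an equivalence relation and $G_L$, with these operations and $\preceq$, is a (well-defined) totally ordered Abelian group (an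 *o-group*). 2. If $L$ is of cancellative type, then $\sim$ is an equivalence relation and $G_L$ is a (well-defined) partially ordered Abelian group; and if $G_L$ is moreover totally ordered by $\preceq$, that is, an o-group, then $L$ is a BL-chain. -/

import Mathlib

universe u v w

/-- A hoop: a commutative monoid `(A, ⊗, 1)`, with `⊗` written `*`, and an implication `⇨`. -/
class Hoop (A : Type u) extends CommMonoid A, HImp A where
  himp_self' : ∀ x : A, x ⇨ x = 1
  mul_himp' : ∀ x y : A, x * (x ⇨ y) = y * (y ⇨ x)
  himp_himp' : ∀ x y z : A, x ⇨ (y ⇨ z) = (x * y) ⇨ z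

namespace Hoop

variable {A : Type u} [Hoop A]

theorem one_himp_and (x : A) : (1 : A) ⇨ x = x ∧ x ⇨ (1 : A) = 1 := by
  have key : ∀ y : A, (1 : A) ⇨ y = y * (y ⇨ 1) := fun y => by
    rw [← mul_himp', one_mul]
  have h1 : (1 : A) ⇨ (x ⇨ 1) = x ⇨ 1 := by rw [himp_himp', one_mul]
  have h2 : x ⇨ 1 = (x ⇨ 1) * ((x ⇨ 1) ⇨ 1) := by rw [← key, h1]
  have h3 : x ⇨ ((1 : A) ⇨ x) = 1 := by rw [himp_himp', mul_one, himp_self']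
  have h4 : ((1 : A) ⇨ x) ⇨ x = (x ⇨ 1) ⇨ 1 := by
    rw [key, mul_comm, ← himp_himp', himp_self']
  have h5 : x = x * (x ⇨ 1) := by
    have := mul_himp' x ((1 : A) ⇨ x)
    rw [h3, mul_one, h4, key, mul_assoc, ← h2] at this
    exact this
  refine ⟨by rw [key, ← h5], ?_⟩
  conv_lhs => rw [h5]
  rw [mul_comm, ← himp_himp', himp_self']

theorem one_himp (x : A) : (1 : A) ⇨ x = x := (one_himp_and x).1

theorem himp_one (x : A) : x ⇨ (1 : A) = 1 := (one_himp_and x).2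

/-- The natural order of a hoop: `x ≤ y` iff `x ⇨ y = 1`. -/
instance : PartialOrder A where
  le x y := x ⇨ y = 1
  le_refl := himp_self'
  le_trans x y z hxy hyz := by
    change x ⇨ y = 1 at hxy
    change y ⇨ z = 1 at hyz
    have : x = (y ⇨ x) * y := by rw [mul_comm, ← mul_himp', hxy, mul_one]
    rw [this, ← himp_himp', hyz, himp_one]
  le_antisymm x y hxy hyx := by
    have := mul_himp' x y
    change x ⇨ y = 1 at hxy
    change y ⇨ x = 1 at hyx
    rwa [hxy, hyx, mul_one, mul_one] at this

theorem le_def {x y : A} : x ≤ y ↔ x ⇨ y = 1 := Iff.rfl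

/-- Residuation. -/
theorem mul_le_iff {x y z : A} : x * y ≤ z ↔ x ≤ y ⇨ z := by
  rw [le_def, le_def, himp_himp']

theorem le_one (x : A) : x ≤ 1 := himp_one x

theorem mul_le_mul_l {x y : A} (h : x ≤ y) (z : A) : x * z ≤ y * z :=
  mul_le_iff.2 (h.trans (mul_le_iff.1 le_rfl))

theorem mul_le_l (x y : A) : x * y ≤ x := by
  have := mul_le_mul_l (le_one y) x
  rwa [one_mul, mul_comm] at this

theorem mul_le_r (x y : A) : x * y ≤ y := by rw [mul_comm]; exact mul_le_l y x

theorem mul_himp_le (x y : A) : x * (x ⇨ y) ≤ y := by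
  rw [mul_comm]; exact mul_le_iff.2 le_rfl

/-- The meet `x ∧ y = x ⊗ (x → y)`. -/
instance : SemilatticeInf A where
  inf x y := x * (x ⇨ y)
  inf_le_left x y := mul_le_l _ _
  inf_le_right x y := mul_himp_le _ _
  le_inf x y z hxy hxz := by
    have h : x = (y ⇨ x) * y := by
      have := mul_himp' x y
      rw [le_def.1 hxy, mul_one] at this
      rw [mul_comm]; exact this
    have h2 : (y ⇨ x) ≤ (y ⇨ z) := by
      rw [← mul_le_iff, ← h]; exact hxz
    have h3 := mul_le_mul_l h2 y
    rw [← h, mul_comm] at h3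
    exact h3

theorem inf_def (x y : A) : x ⊓ y = x * (x ⇨ y) := rfl

theorem himp_le_himp_l {x y : A} (h : x ≤ y) (z : A) : z ⇨ x ≤ z ⇨ y := by
  rw [← mul_le_iff, mul_comm]; exact (mul_himp_le z x).trans h

theorem himp_le_himp_r {x y : A} (h : x ≤ y) (z : A) : y ⇨ z ≤ x ⇨ z := by
  rw [← mul_le_iff, mul_comm]; exact (mul_le_mul_l h _).trans (mul_himp_le y z)

theorem le_himp (x y : A) : y ≤ x ⇨ y := by
  rw [← mul_le_iff]; exact mul_le_l y x

end Hoop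

/-- A BL-algebra: a bounded hoop with `(x → y) → z ≤ ((y → x) → z) → z`. -/
class BLAlgebra (L : Type u) extends Hoop L, Zero L where
  zero_le' : ∀ x : L, (0 : L) ⇨ x = 1
  prelinear' : ∀ x y z : L, ((x ⇨ y) ⇨ z) ⇨ (((y ⇨ x) ⇨ z) ⇨ z) = 1

/-- A BL-chain is a BL-algebra whose order is linear. -/
def IsBLChain (L : Type u) [BLAlgebra L] : Prop := ∀ x y : L, x ≤ y ∨ y ≤ x

/-- Homomorphisms of BL-algebras (lattice operations are terms in `⊗`, `→`). -/
structure BLHom (L : Type u) (M : Type v) [BLAlgebra L] [BLAlgebra M] where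
  toFun : L → M
  map_mul' : ∀ x y, toFun (x * y) = toFun x * toFun y
  map_himp' : ∀ x y, toFun (x ⇨ y) = toFun x ⇨ toFun y
  map_zero' : toFun 0 = 0
  map_one' : toFun 1 = 1

namespace BLAlgebra

open Hoop

section Basic

variable {L : Type u} [BLAlgebra L]

/-- The complement `x̄ = x → 0`. -/
instance : Compl L := ⟨fun x => x ⇨ 0⟩

/-- The addition `x + y = (x̄ → y) ∧ (ȳ → x)`. -/
instance : Add L := ⟨fun x y => (xᶜ ⇨ y) ⊓ (yᶜ ⇨ x)⟩

theorem compl_def (x : L) : xᶜ = x ⇨ 0 := rfl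

theorem add_def (x y : L) : x + y = (xᶜ ⇨ y) ⊓ (yᶜ ⇨ x) := rfl

theorem bot_le' (x : L) : 0 ≤ x := zero_le' x

theorem eq_zero_of_le {x : L} (h : x ≤ 0) : x = 0 := le_antisymm h (bot_le' x)

theorem zero_mul' (x : L) : 0 * x = 0 := eq_zero_of_le (mul_le_l 0 x)

theorem mul_zero' (x : L) : x * 0 = 0 := eq_zero_of_le (mul_le_r x 0)

theorem zero_compl : (0 : L)ᶜ = 1 := himp_self' 0

theorem one_compl : (1 : L)ᶜ = 0 := one_himp 0

theorem mul_compl' (x : L) : x * xᶜ = 0 := eq_zero_of_le (mul_himp_le x 0)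

theorem le_compl_compl (x : L) : x ≤ xᶜᶜ := by
  rw [compl_def xᶜ, ← mul_le_iff, mul_compl']

theorem compl_anti {x y : L} (h : x ≤ y) : yᶜ ≤ xᶜ := himp_le_himp_r h 0

theorem compl3 (x : L) : xᶜᶜᶜ = xᶜ :=
  le_antisymm (compl_anti (le_compl_compl x)) (le_compl_compl _)

theorem himp_compl (x y : L) : x ⇨ yᶜ = (x * y)ᶜ := himp_himp' x y 0

theorem badd_comm (x y : L) : x + y = y + x := inf_comm _ _

theorem zero_badd (x : L) : 0 + x = x := by
  rw [add_def, zero_compl, one_himp]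
  exact inf_eq_left.2 (le_compl_compl x)

theorem one_badd (x : L) : 1 + x = 1 := by
  rw [add_def, one_compl, le_def.1 (bot_le' x), himp_one, inf_idem]

theorem le_badd_left (x y : L) : x ≤ x + y := by
  refine le_inf ?_ (le_himp _ _)
  exact (le_compl_compl x).trans (himp_le_himp_l (bot_le' y) _)

/-- If `e ∨ f = 1`, stated without the join. -/
theorem prelinear_one {x y z : L} (h1 : x ⇨ y ≤ z) (h2 : y ⇨ x ≤ z) : z = 1 := by
  have := prelinear' x y z
  rw [le_def.1 h1, le_def.1 h2, one_himp, one_himp] at this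
  exact this

/-! ### Chains -/

theorem compl_himp_self (x : L) : (xᶜᶜ ⇨ x)ᶜ = 0 := by
  have h1 : (xᶜᶜ ⇨ x)ᶜ ≤ xᶜᶜ := by
    refine compl_anti ?_
    have := himp_le_himp_l (bot_le' x) xᶜᶜ
    rwa [← compl_def, compl3] at this
  have h2 : xᶜᶜ ⇨ (xᶜᶜ ⇨ x)ᶜ = xᶜ := by
    rw [himp_compl, ← inf_def, inf_eq_right.2 (le_compl_compl x)]
  have h3 := inf_eq_right.2 h1
  rw [inf_def, h2, mul_comm, mul_compl'] at h3
  exact h3.symm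

theorem regular_or_dense (hL : IsBLChain L) (x : L) : xᶜᶜ = x ∨ xᶜ = 0 := by
  have he := compl_himp_self x
  rcases hL (xᶜᶜ ⇨ x) xᶜᶜ with h | h
  · right
    have := compl_anti h
    rw [he, compl3] at this
    exact eq_zero_of_le this
  · left
    have h1 : (xᶜᶜ ⇨ x) ⇨ xᶜᶜ = xᶜᶜ := by
      rw [himp_compl, mul_comm, ← himp_compl, he, compl_def xᶜ]
    have h2 := inf_eq_right.2 h
    rw [inf_def, h1, mul_comm, ← inf_def, inf_eq_right.2 (le_compl_compl x)] at h2
    exact h2.symm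

theorem dense_add (hL : IsBLChain L) {x y : L} (hx : xᶜ = 0) (hy : y ≠ 0) : x + y = 1 := by
  rw [add_def, hx, le_def.1 (bot_le' y)]
  have : yᶜ ≤ x := by
    rcases hL yᶜ x with h | h
    · exact h
    · exfalso
      apply hy
      have := compl_anti h
      rw [hx] at this
      exact eq_zero_of_le ((le_compl_compl y).trans this)
  rw [le_def.1 this, inf_idem]

theorem regular_add {x y : L} (hx : xᶜᶜ = x) (hy : yᶜᶜ = y) : x + y = (xᶜ * yᶜ)ᶜ := by
  have h1 : xᶜ ⇨ y = (xᶜ * yᶜ)ᶜ := by rw [← himp_compl, hy]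
  have h2 : yᶜ ⇨ x = (xᶜ * yᶜ)ᶜ := by rw [mul_comm, ← himp_compl, hx]
  rw [add_def, h1, h2, inf_idem]

theorem compl_compl_mul (x y : L) : (xᶜᶜ * y)ᶜ = (x * y)ᶜ := by
  rw [mul_comm, ← himp_compl, compl3, himp_compl, mul_comm]

theorem chain_add_eq_zero {x y : L} (h : x + y = 0) : x = 0 :=
  eq_zero_of_le (h ▸ le_badd_left x y)

theorem chain_add_assoc (hL : IsBLChain L) (x y z : L) : x + y + z = x + (y + z) := by
  by_cases x0 : x = 0
  · rw [x0, zero_badd, zero_badd]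
  by_cases y0 : y = 0
  · rw [y0, badd_comm x, zero_badd, zero_badd]
  by_cases z0 : z = 0
  · rw [z0, badd_comm, zero_badd, badd_comm y, zero_badd]
  have hyz : y + z ≠ 0 := fun h => y0 (chain_add_eq_zero h)
  have hxy : x + y ≠ 0 := fun h => x0 (chain_add_eq_zero h)
  rcases regular_or_dense hL x with hx | hx
  · rcases regular_or_dense hL y with hy | hy
    · rcases regular_or_dense hL z with hz | hz
      · have h1 : (x + y)ᶜᶜ = x + y := by rw [regular_add hx hy, compl3]
        have h2 : (y + z)ᶜᶜ = y + z := by rw [regular_add hy hz, compl3]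
        rw [regular_add h1 hz, regular_add hx h2, regular_add hx hy, regular_add hy hz,
          compl_compl_mul, mul_comm xᶜ (_)ᶜᶜ, compl_compl_mul, mul_assoc, mul_comm xᶜ]
      · rw [badd_comm _ z, dense_add hL hz hxy, badd_comm y z, dense_add hL hz y0, badd_comm x,
          one_badd]
    · rw [badd_comm x y, dense_add hL hy x0, one_badd, dense_add hL hy z0, badd_comm, one_badd]
  · rw [dense_add hL hx y0, one_badd, dense_add hL hx hyz]

theorem chain_add_eq_self (hL : IsBLChain L) {x y : L} : x + y = x ↔ x = 1 ∨ y = 0 := by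
  constructor
  · intro h
    by_cases y0 : y = 0
    · exact Or.inr y0
    left
    rcases regular_or_dense hL x with hx | hx
    · rcases regular_or_dense hL y with hy | hy
      · have h1 : xᶜ ⇨ y = x := by
          rw [regular_add hx hy] at h
          rw [← hy, himp_compl, h]
        have h2 : xᶜ ⊓ y = 0 := by rw [inf_def, h1, mul_comm, mul_compl']
        rcases hL xᶜ y with h3 | h3
        · rw [inf_eq_left.2 h3] at h2
          rw [← hx, h2, zero_compl]
        · rw [inf_eq_right.2 h3] at h2
          exact absurd h2 y0
      · by_cases x0 : x = 0
        · rw [x0, zero_badd] at h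
          exact absurd h y0
        · rw [← h, badd_comm, dense_add hL hy x0]
    · rw [← h, dense_add hL hx y0]
  · rintro (h | h)
    · rw [h, one_badd]
    · rw [h, badd_comm, zero_badd]

theorem chain_add_eq_one (hL : IsBLChain L) {x y : L} (h : x * y ≠ 0) : x + y = 1 := by
  have h1 : xᶜ ≤ y := by
    rcases hL xᶜ y with h' | h'
    · exact h'
    · exact absurd (eq_zero_of_le (by rw [mul_comm]; exact mul_le_iff.2 h')) h
  have h2 : yᶜ ≤ x := by
    rcases hL yᶜ x with h' | h'
    · exact h'
    · exact absurd (eq_zero_of_le (mul_le_iff.2 h')) h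
  rw [add_def, le_def.1 h1, le_def.1 h2, inf_idem]

end Basic

end BLAlgebra

namespace BLHom

open Hoop BLAlgebra

variable {L : Type u} {M : Type v} [BLAlgebra L] [BLAlgebra M]

theorem map_compl (f : BLHom L M) (x : L) : f.toFun xᶜ = (f.toFun x)ᶜ := by
  rw [compl_def, f.map_himp', f.map_zero', compl_def]

theorem map_inf (f : BLHom L M) (x y : L) : f.toFun (x ⊓ y) = f.toFun x ⊓ f.toFun y := by
  rw [inf_def, f.map_mul', f.map_himp', inf_def]

theorem map_add (f : BLHom L M) (x y : L) : f.toFun (x + y) = f.toFun x + f.toFun y := by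
  rw [add_def, f.map_inf, f.map_himp', f.map_himp', f.map_compl, f.map_compl, add_def]

end BLHom

/-! ### Enough homomorphisms onto chains -/

namespace BLAlgebra

open Hoop

variable {L : Type u} [BLAlgebra L]

/-- Filters (deductive systems) of a BL-algebra. -/
structure IsBLFilter (F : Set L) : Prop where
  one_mem : (1 : L) ∈ F
  mp : ∀ {x y : L}, x ∈ F → x ⇨ y ∈ F → y ∈ F

namespace IsBLFilter



theorem up {F : Set L} (hF : IsBLFilter F) {x y : L} (hx : x ∈ F) (h : x ≤ y) : y ∈ F :=
  hF.mp hx (by rw [le_def.1 h]; exact hF.one_mem)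

theorem mul {F : Set L} (hF : IsBLFilter F) {x y : L} (hx : x ∈ F) (hy : y ∈ F) :
    x * y ∈ F :=
  hF.mp hy (hF.up hx (mul_le_iff.1 le_rfl))

/-- The congruence of a filter. -/
def setoid {F : Set L} (hF : IsBLFilter F) : Setoid L where
  r x y := x ⇨ y ∈ F ∧ y ⇨ x ∈ F
  iseqv := by
    have tr : ∀ {x y z : L}, x ⇨ y ∈ F → y ⇨ z ∈ F → x ⇨ z ∈ F := by
      intro x y z h1 h2
      refine hF.up (hF.mul h1 h2) ?_
      rw [← mul_le_iff, mul_comm, ← mul_assoc]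
      exact (mul_le_mul_l (mul_himp_le x y) _).trans (mul_himp_le y z)
    refine ⟨fun x => ?_, fun h => ⟨h.2, h.1⟩, fun h1 h2 => ⟨tr h1.1 h2.1, tr h2.2 h1.2⟩⟩
    rw [himp_self']
    exact ⟨hF.one_mem, hF.one_mem⟩

theorem mul_congr {F : Set L} (hF : IsBLFilter F) {x x' y y' : L} (h1 : x ⇨ x' ∈ F)
    (h2 : y ⇨ y' ∈ F) : (x * y) ⇨ (x' * y') ∈ F := by
  refine hF.up (hF.mul h1 h2) ?_
  rw [← mul_le_iff]
  calc (x ⇨ x') * (y ⇨ y') * (x * y) = (x * (x ⇨ x')) * (y * (y ⇨ y')) := by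
        rw [mul_comm, mul_mul_mul_comm]
    _ ≤ x' * (y * (y ⇨ y')) := mul_le_mul_l (mul_himp_le _ _) _
    _ = (y * (y ⇨ y')) * x' := mul_comm _ _
    _ ≤ y' * x' := mul_le_mul_l (mul_himp_le _ _) _
    _ = x' * y' := mul_comm _ _

theorem himp_congr {F : Set L} (hF : IsBLFilter F) {x x' y y' : L} (h1 : x' ⇨ x ∈ F)
    (h2 : y ⇨ y' ∈ F) : (x ⇨ y) ⇨ (x' ⇨ y') ∈ F := by
  refine hF.up (hF.mul h1 h2) ?_
  rw [← mul_le_iff, ← mul_le_iff]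
  calc (x' ⇨ x) * (y ⇨ y') * (x ⇨ y) * x'
        = (x' * (x' ⇨ x)) * ((x ⇨ y) * (y ⇨ y')) := by
        rw [mul_comm, mul_comm ((x' ⇨ x) * _), mul_left_comm (x ⇨ y), ← mul_assoc]
    _ ≤ x * ((x ⇨ y) * (y ⇨ y')) := mul_le_mul_l (mul_himp_le _ _) _
    _ = (x * (x ⇨ y)) * (y ⇨ y') := (mul_assoc _ _ _).symm
    _ ≤ y * (y ⇨ y') := mul_le_mul_l (mul_himp_le _ _) _
    _ ≤ y' := mul_himp_le _ _

/-- The quotient BL-algebra by a filter. -/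
@[reducible] def quot {F : Set L} (hF : IsBLFilter F) : BLAlgebra (Quotient hF.setoid) where
  mul := Quotient.map₂ (· * ·) fun _ _ h1 _ _ h2 =>
    ⟨hF.mul_congr h1.1 h2.1, hF.mul_congr h1.2 h2.2⟩
  himp := Quotient.map₂ (· ⇨ ·) fun _ _ h1 _ _ h2 =>
    ⟨hF.himp_congr h1.2 h2.1, hF.himp_congr h1.1 h2.2⟩
  one := Quotient.mk _ 1
  zero := Quotient.mk _ 0
  mul_assoc := by
    rintro ⟨x⟩ ⟨y⟩ ⟨z⟩; exact congrArg (Quotient.mk _) (mul_assoc x y z)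
  mul_comm := by
    rintro ⟨x⟩ ⟨y⟩; exact congrArg (Quotient.mk _) (mul_comm x y)
  one_mul := by
    rintro ⟨x⟩; exact congrArg (Quotient.mk _) (one_mul x)
  mul_one := by
    rintro ⟨x⟩; exact congrArg (Quotient.mk _) (mul_one x)
  himp_self' := by
    rintro ⟨x⟩; exact congrArg (Quotient.mk _) (himp_self' x)
  mul_himp' := by
    rintro ⟨x⟩ ⟨y⟩; exact congrArg (Quotient.mk _) (mul_himp' x y)
  himp_himp' := by
    rintro ⟨x⟩ ⟨y⟩ ⟨z⟩; exact congrArg (Quotient.mk _) (himp_himp' x y z)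
  zero_le' := by
    rintro ⟨x⟩; exact congrArg (Quotient.mk _) (zero_le' x)
  prelinear' := by
    rintro ⟨x⟩ ⟨y⟩ ⟨z⟩; exact congrArg (Quotient.mk _) (prelinear' x y z)

/-- The filter generated by a filter `F` and an element `e`. -/
theorem adjoin {F : Set L} (hF : IsBLFilter F) (e : L) :
    IsBLFilter {x : L | ∃ n : ℕ, e ^ n ⇨ x ∈ F} where
  one_mem := ⟨0, by rw [himp_one]; exact hF.one_mem⟩
  mp := by
    rintro x y ⟨n, hn⟩ ⟨m, hm⟩
    refine ⟨n + m, hF.up (hF.mul hn hm) ?_⟩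
    rw [← mul_le_iff, pow_add]
    calc (e ^ n ⇨ x) * (e ^ m ⇨ x ⇨ y) * (e ^ n * e ^ m)
          = (e ^ n * (e ^ n ⇨ x)) * (e ^ m * (e ^ m ⇨ x ⇨ y)) := by
          rw [mul_comm, mul_mul_mul_comm]
      _ ≤ x * (e ^ m * (e ^ m ⇨ x ⇨ y)) := mul_le_mul_l (mul_himp_le _ _) _
      _ = (e ^ m * (e ^ m ⇨ x ⇨ y)) * x := mul_comm _ _
      _ ≤ (x ⇨ y) * x := mul_le_mul_l (mul_himp_le _ _) _
      _ ≤ y := by rw [mul_comm]; exact mul_himp_le _ _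

end IsBLFilter

theorem prelinear_pow_aux {e f : L} (h : ∀ z, e ≤ z → f ≤ z → z = 1) (n : ℕ) :
    ∀ z, e ^ n ≤ z → f ≤ z → z = 1 := by
  induction n with
  | zero =>
    intro z hz _
    rw [pow_zero] at hz
    exact le_antisymm (le_one z) hz
  | succ n ih =>
    intro z hz hf
    rw [pow_succ, mul_le_iff] at hz
    have h1 := ih _ hz (hf.trans (le_himp _ _))
    exact h z (le_def.2 h1) hf

theorem exists_prime {a : L} (ha : a ≠ 1) :
    ∃ F : Set L, IsBLFilter F ∧ a ∉ F ∧ ∀ x y : L, x ⇨ y ∈ F ∨ y ⇨ x ∈ F := by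
  have h1 : IsBLFilter ({1} : Set L) :=
    ⟨rfl, by
      rintro x y hx hxy
      rw [Set.mem_singleton_iff] at *
      rw [hx, one_himp] at hxy
      exact hxy⟩
  obtain ⟨F, -, hF⟩ := zorn_subset_nonempty {F : Set L | IsBLFilter F ∧ a ∉ F}
    (fun c hc hch ⟨F₀, hF₀⟩ => by
      refine ⟨⋃₀ c, ⟨⟨⟨F₀, hF₀, (hc hF₀).1.one_mem⟩, ?_⟩, ?_⟩, fun s hs =>
        Set.subset_sUnion_of_mem hs⟩
      · rintro x y ⟨s, hs, hx⟩ ⟨t, ht, hxy⟩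
        rcases hch.total hs ht with h | h
        · exact ⟨t, ht, (hc ht).1.mp (h hx) hxy⟩
        · exact ⟨s, hs, (hc hs).1.mp hx (h hxy)⟩
      · rintro ⟨s, hs, h⟩
        exact (hc hs).2 h) {1} ⟨h1, ha⟩
  have hFf := hF.prop.1
  have key : ∀ e : L, e ∉ F → ∃ n : ℕ, e ^ n ⇨ a ∈ F := by
    intro e he
    by_contra hcon
    refine he (hF.le_of_ge ⟨hFf.adjoin e, hcon⟩ ?_ ⟨1, ?_⟩)
    · exact fun x hx => ⟨0, hFf.up hx (le_himp _ _)⟩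
    · rw [pow_one, himp_self']; exact hFf.one_mem
  refine ⟨F, hFf, hF.prop.2, fun x y => ?_⟩
  by_contra hcon
  rw [not_or] at hcon
  obtain ⟨n, hn⟩ := key _ hcon.1
  obtain ⟨m, hm⟩ := key _ hcon.2
  have hg := hFf.mul hn hm
  refine hF.prop.2 (hFf.mp hg ?_)
  have e1 : (x ⇨ y) ^ n ≤ (((x ⇨ y) ^ n ⇨ a) * ((y ⇨ x) ^ m ⇨ a)) ⇨ a := by
    rw [← mul_le_iff, ← mul_assoc]
    exact (mul_le_l _ _).trans (mul_himp_le _ _)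
  have e2 : (y ⇨ x) ^ m ≤ (((x ⇨ y) ^ n ⇨ a) * ((y ⇨ x) ^ m ⇨ a)) ⇨ a := by
    rw [← mul_le_iff, mul_left_comm]
    exact (mul_le_r _ _).trans (mul_himp_le _ _)
  have p1 := prelinear_pow_aux (e := x ⇨ y) (f := y ⇨ x)
    (fun z h h' => prelinear_one h h') n
  have p2 := prelinear_pow_aux (e := y ⇨ x) (f := (x ⇨ y) ^ n)
    (fun z h h' => p1 z h' h) m
  rw [p2 _ e2 e1]
  exact hFf.one_mem

theorem exists_chain_hom {a : L} (ha : a ≠ 1) :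
    ∃ (C : Type u) (_ : BLAlgebra C) (f : BLHom L C), IsBLChain C ∧ f.toFun a ≠ 1 := by
  obtain ⟨F, hF, haF, hp⟩ := exists_prime ha
  let _ := hF.quot
  have hmem : ∀ x : L, (Quotient.mk hF.setoid x = 1) ↔ x ∈ F := by
    intro x
    constructor
    · intro h
      have := (Quotient.exact h : _ ∧ _).2
      rwa [one_himp] at this
    · intro h
      refine Quotient.sound ⟨?_, ?_⟩
      · rw [himp_one]; exact hF.one_mem
      · rw [one_himp]; exact h
  refine ⟨Quotient hF.setoid, hF.quot, ⟨Quotient.mk _, fun _ _ => rfl, fun _ _ => rfl, rfl, rfl⟩,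
    ?_, fun h => haF ((hmem a).1 h)⟩
  rintro ⟨x⟩ ⟨y⟩
  exact (hp x y).imp (hmem _).2 (hmem _).2

/-- An equality holds if it holds after every homomorphism to a chain. -/
theorem eq_of_chain {x y : L}
    (h : ∀ (C : Type u) [BLAlgebra C] (f : BLHom L C), IsBLChain C → f.toFun x = f.toFun y) :
    x = y := by
  have aux : ∀ x y : L, (∀ (C : Type u) [BLAlgebra C] (f : BLHom L C), IsBLChain C →
      f.toFun x = f.toFun y) → x ≤ y := by
    intro x y h
    by_contra hcon
    obtain ⟨C, _, f, hC, hf⟩ := exists_chain_hom hcon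
    apply hf
    rw [f.map_himp', h C f hC, himp_self']
  exact le_antisymm (aux x y h) (aux y x fun C _ f hC => (h C f hC).symm)

/-- `(L, +, 0)` is a commutative monoid. -/
instance : AddCommMonoid L where
  add_assoc x y z := eq_of_chain fun C _ f hC => by
    simp only [f.map_add]
    exact chain_add_assoc hC _ _ _
  zero_add := zero_badd
  add_zero x := by rw [badd_comm, zero_badd]
  add_comm := badd_comm
  nsmul := nsmulRec

end BLAlgebra

/-! ### Good sequences -/

open Hoop BLAlgebra

/-- A sequence is good if `aᵢ + aᵢ₊₁ = aᵢ` for all `i` and almost all of its terms vanish.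
Indices start at `0`, so that `a i` is the `(i + 1)`-st term. -/
structure IsGoodSeq {L : Type u} [BLAlgebra L] (a : ℕ → L) : Prop where
  add_eq : ∀ i, a i + a (i + 1) = a i
  eventually_zero : ∃ n, ∀ r, n ≤ r → a r = 0

/-- The sum of sequences. With terms numbered from `1` this is
`cᵢ = aᵢ + (aᵢ₋₁ ⊗ b₁) + ⋯ + (a₁ ⊗ bᵢ₋₁) + bᵢ`. -/
def seqAdd {L : Type u} [BLAlgebra L] (a b : ℕ → L) (i : ℕ) : L :=
  a i + (∑ j ∈ Finset.range i, a (i - 1 - j) * b j) + b i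

/-- `a` preceded by `1`. -/
def seqCons {L : Type u} [BLAlgebra L] (a : ℕ → L) : ℕ → L
  | 0 => 1
  | n + 1 => a n

theorem seqAdd_eq {L : Type u} [BLAlgebra L] (a b : ℕ → L) (i : ℕ) :
    seqAdd a b i =
      ∑ p ∈ Finset.HasAntidiagonal.antidiagonal (i + 1), seqCons a p.1 * seqCons b p.2 := by
  rw [seqAdd, Finset.Nat.antidiagonal_succ, Finset.sum_cons, Finset.sum_map]
  cases i with
  | zero => simp [seqCons, add_comm]
  | succ n =>
    rw [Finset.Nat.antidiagonal_succ', Finset.sum_cons, Finset.sum_map,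
      ← Finset.Nat.sum_antidiagonal_swap, Finset.Nat.sum_antidiagonal_eq_sum_range_succ_mk]
    simp [seqCons]
    rw [add_comm]

theorem BLAlgebra.le_sum {L : Type u} [BLAlgebra L] {ι : Type*} [DecidableEq ι] (s : Finset ι)
    (f : ι → L) {i : ι} (hi : i ∈ s) : f i ≤ ∑ k ∈ s, f k := by
  rw [← Finset.add_sum_erase s f hi]
  exact le_badd_left _ _

theorem BLHom.map_seqAdd {L : Type u} {M : Type v} [BLAlgebra L] [BLAlgebra M] (f : BLHom L M)
    (a b : ℕ → L) (i : ℕ) :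
    f.toFun (seqAdd a b i) = seqAdd (fun n => f.toFun (a n)) (fun n => f.toFun (b n)) i := by
  have hs := map_sum (⟨⟨f.toFun, f.map_zero'⟩, f.map_add⟩ : L →+ M)
    (fun j => a (i - 1 - j) * b j) (Finset.range i)
  simp only [AddMonoidHom.coe_mk, ZeroHom.coe_mk, f.map_mul'] at hs
  rw [seqAdd, f.map_add, f.map_add, hs, seqAdd]

theorem chain_seqAdd_good {L : Type u} [BLAlgebra L] (hL : IsBLChain L) {a b : ℕ → L}
    (ha : ∀ i, a i + a (i + 1) = a i) (hb : ∀ i, b i + b (i + 1) = b i) (i : ℕ) :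
    seqAdd a b i + seqAdd a b (i + 1) = seqAdd a b i := by
  have hone : ∀ {x : L}, 1 ≤ x → x = 1 := fun h => le_antisymm (le_one _) h
  rw [chain_add_eq_self hL]
  by_contra hcon
  rw [not_or, seqAdd_eq, seqAdd_eq] at hcon
  obtain ⟨h1, h2⟩ := hcon
  obtain ⟨⟨s, t⟩, hst, hne⟩ := Finset.exists_ne_zero_of_sum_ne_zero h2
  rw [Finset.HasAntidiagonal.mem_antidiagonal] at hst
  have hcons : ∀ {c : ℕ → L}, (∀ i, c i + c (i + 1) = c i) → ∀ n, seqCons c (n + 1) ≠ 0 →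
      seqCons c n = 1 := by
    intro c hc n hn
    cases n with
    | zero => rfl
    | succ n => exact ((chain_add_eq_self hL).1 (hc n)).resolve_right hn
  have hs0 : seqCons a s ≠ 0 := fun h => hne (by simp only [h, zero_mul'])
  have ht0 : seqCons b t ≠ 0 := fun h => hne (by simp only [h, mul_zero'])
  apply h1
  let F : ℕ × ℕ → L := fun p => seqCons a p.1 * seqCons b p.2
  change ∑ p ∈ Finset.HasAntidiagonal.antidiagonal (i + 1), F p = 1
  rcases s with _ | s
  · have ht : t = i + 1 + 1 := by simpa using hst
    subst ht
    refine hone (le_trans (le_of_eq ?_)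
      (le_sum _ F (i := (0, i + 1)) (by simp)))
    change (1 : L) = seqCons a 0 * seqCons b (i + 1)
    rw [hcons hb _ ht0]
    exact (mul_one 1).symm
  rcases t with _ | t
  · have hs : s = i + 1 := by simpa using hst
    subst hs
    refine hone (le_trans (le_of_eq ?_)
      (le_sum _ F (i := (i + 1, 0)) (by simp)))
    change (1 : L) = seqCons a (i + 1) * seqCons b 0
    rw [hcons ha _ hs0]
    exact (mul_one 1).symm
  have hm1 : (s, t + 1) ∈ Finset.HasAntidiagonal.antidiagonal (i + 1) := by
    simp only [Finset.HasAntidiagonal.mem_antidiagonal] at *; omega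
  have hm2 : (s + 1, t) ∈ (Finset.HasAntidiagonal.antidiagonal (i + 1)).erase (s, t + 1) := by
    simp only [Finset.mem_erase, Finset.HasAntidiagonal.mem_antidiagonal, ne_eq, Prod.mk.injEq] at *; omega
  rw [← Finset.add_sum_erase _ F hm1, ← Finset.add_sum_erase _ F hm2, ← add_assoc]
  have e : F (s, t + 1) + F (s + 1, t) = 1 := by
    simp only [F, hcons ha _ hs0, hcons hb _ ht0, one_mul, mul_one]
    rw [add_comm]
    exact chain_add_eq_one hL hne
  rw [e, one_badd]

theorem IsGoodSeq.add {L : Type u} [BLAlgebra L] {a b : ℕ → L} (ha : IsGoodSeq a)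
    (hb : IsGoodSeq b) : IsGoodSeq (seqAdd a b) where
  add_eq i := eq_of_chain fun C _ f hC => by
    rw [f.map_add, f.map_seqAdd, f.map_seqAdd]
    refine chain_seqAdd_good hC (fun i => ?_) (fun i => ?_) i
    · rw [← f.map_add, ha.add_eq]
    · rw [← f.map_add, hb.add_eq]
  eventually_zero := by
    obtain ⟨m, hm⟩ := ha.eventually_zero
    obtain ⟨n, hn⟩ := hb.eventually_zero
    refine ⟨m + n, fun r hr => ?_⟩
    rw [seqAdd, hm r (by omega), hn r (by omega), Finset.sum_eq_zero, add_zero, add_zero]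
    intro j hj
    rw [Finset.mem_range] at hj
    by_cases h : n ≤ j
    · rw [hn j h, mul_zero']
    · rw [hm _ (by omega), zero_mul']

/-- `M_L`, the set of good sequences of `L`. -/
def GoodSeq (L : Type u) [BLAlgebra L] : Type u := {a : ℕ → L // IsGoodSeq a}

namespace GoodSeq

variable {L : Type u} [BLAlgebra L]

instance : Add (GoodSeq L) := ⟨fun a b => ⟨seqAdd a.1 b.1, a.2.add b.2⟩⟩

/-- The sequence `(0)`. -/
instance : Zero (GoodSeq L) := ⟨⟨fun _ => 0, fun _ => add_zero 0, 0, fun _ _ => rfl⟩⟩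

/-- The componentwise order. -/
instance : PartialOrder (GoodSeq L) := PartialOrder.lift Subtype.val Subtype.val_injective

end GoodSeq

/-! ### The group `G_L` -/

/-- The relation `(a, b) ∼ (c, d)`: there is `k ∈ M_L` with `a + d + k = b + c + k`. Sums of three
good sequences are bracketed to the left, addition in `M_L` not being associative in general. -/
def ChangRel (L : Type u) [BLAlgebra L] (x y : GoodSeq L × GoodSeq L) : Prop :=
  ∃ k : GoodSeq L, (x.1 + y.2) + k = (x.2 + y.1) + k

/-- `G_L = (M_L × M_L) / ∼`. -/
def ChangGroup (L : Type u) [BLAlgebra L] : Type u := Quot (ChangRel L)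

/-- The class `[a, b]`. -/
def ChangGroup.mk {L : Type u} [BLAlgebra L] (a b : GoodSeq L) : ChangGroup L :=
  Quot.mk _ (a, b)

/-- The prescribed operations and order on `G_L`. As every element is a class `[a, b]`, these
formulas determine the group structure and the order completely. -/
structure IsChangStructure (L : Type u) [BLAlgebra L] [AddCommGroup (ChangGroup L)]
    [PartialOrder (ChangGroup L)] : Prop where
  add_mk : ∀ a b c d : GoodSeq L,
    ChangGroup.mk a b + ChangGroup.mk c d = ChangGroup.mk (a + c) (b + d)
  zero_eq : (0 : ChangGroup L) = ChangGroup.mk 0 0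
  neg_mk : ∀ a b : GoodSeq L, -ChangGroup.mk a b = ChangGroup.mk b a
  mk_le_mk : ∀ a b c d : GoodSeq L, ChangGroup.mk a b ≤ ChangGroup.mk c d ↔
    ∃ k : GoodSeq L, (a + d) + k ≤ (b + c) + k

/-- `∼` is an equivalence relation, and `G_L` with the prescribed operations and order is a (well
defined) partially ordered Abelian group. -/
def ChangGroup.IsPoGroup (L : Type u) [BLAlgebra L] : Prop :=
  Equivalence (ChangRel L) ∧
    ∃ (_ : AddCommGroup (ChangGroup L)) (_ : PartialOrder (ChangGroup L)),
      IsChangStructure L ∧ IsOrderedAddMonoid (ChangGroup L)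

/-- `G_L` is an o-group: a (well defined) totally ordered Abelian group. -/
def ChangGroup.IsOGroup (L : Type u) [BLAlgebra L] : Prop :=
  Equivalence (ChangRel L) ∧
    ∃ (_ : AddCommGroup (ChangGroup L)) (_ : PartialOrder (ChangGroup L)),
      IsChangStructure L ∧ IsOrderedAddMonoid (ChangGroup L) ∧
        ∀ x y : ChangGroup L, x ≤ y ∨ y ≤ x

/-! ### Cancellative type -/

/-- A BL-chain of cancellative type. -/
def IsCancellativeChain (C : Type u) [BLAlgebra C] : Prop :=
  IsBLChain C ∧ ∀ x y z : C, x + y = x + z → x * y = x * z → y = z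

/-- A BL-algebra of cancellative type: a subdirect product of BL-chains of cancellative type,
that is, there is a jointly injective family of surjective homomorphisms onto such chains. -/
def IsOfCancellativeType (L : Type u) [BLAlgebra L] : Prop :=
  ∃ (I : Type v) (C : I → Type w) (_ : ∀ i, BLAlgebra (C i)) (π : ∀ i, BLHom L (C i)),
    (∀ i, IsCancellativeChain (C i)) ∧ (∀ i, Function.Surjective (π i).toFun) ∧
      ∀ x y : L, (∀ i, (π i).toFun x = (π i).toFun y) → x = y

/-! In a chain every element is regular (`xᶜᶜ = x`) or dense (`xᶜ = 0`), and a good sequence has the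
form `(1, …, 1, x, 0, …)`, a `stair`. Two stairs add by forming `x + y` and `x * y`, where `x + y =
1` or `x * y = 0`; associativity and cancellation in `M_L` thus become identities between elements
(`IsAssocSet`, `IsCancelSet`). Regular elements satisfy both; if all nonzero elements are dense,
associativity still holds.

The obstacle is that `M_L` need not be associative: for `d ≠ 1` dense and `e` neither zero nor
dense, `((d) + (e)) + (eᶜ) = (1, 1)` but `(d) + ((e) + (eᶜ)) = (1, d)`. So `G_L` is studied through
an additive monotone map `φ` into a genuine ordered commutative monoid that detects equality and
order up to a summand (`IsReflecting`).

If a chain has such an `e`, take for `φ` termwise double complementation. The sequences of regular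
elements form a cancellative monoid, and adding `(e)` to a sequence erases the difference between it
and its regularization (`add_single`). Otherwise all nonzero elements are dense, `M_L` is
associative, and `φ = id`.

A chain of cancellative type consists of regular elements only, or its nonzero elements are all
dense. Associativity and order cancellation hold in each factor and pass to the subdirect product.
Cancellation makes `x ↦ [(x), (0)]` reflect the order, so `L` is linear if `G_L` is. -/

namespace ChangGroup

/-! ### The group `G_L` computed through a reflecting map. -/

variable {L : Type u} [BLAlgebra L]

/-- A map to an ordered commutative monoid through which `ChangRel` and the order of `G_L` can be
computed. -/
structure IsReflecting {N : Type v} [AddCommMonoid N] [PartialOrder N]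
    (φ : GoodSeq L → N) : Prop where
  map_add : ∀ a b, φ (a + b) = φ a + φ b
  map_zero : φ 0 = 0
  mono : Monotone φ
  reflect_eq : ∀ a b k, φ a + φ k = φ b + φ k → ∃ k', a + k' = b + k'
  reflect_le : ∀ a b k, φ a + φ k ≤ φ b + φ k → ∃ k', a + k' ≤ b + k'

namespace IsReflecting

variable {N : Type v} [AddCommMonoid N] [PartialOrder N] {φ : GoodSeq L → N}

theorem rel_iff (h : IsReflecting φ) {x y : GoodSeq L × GoodSeq L} :
    ChangRel L x y ↔ ∃ k, φ x.1 + φ y.2 + φ k = φ x.2 + φ y.1 + φ k := by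
  constructor
  · rintro ⟨k, hk⟩
    refine ⟨k, ?_⟩
    simpa only [h.map_add] using congrArg φ hk
  · rintro ⟨k, hk⟩
    refine h.reflect_eq (x.1 + y.2) (x.2 + y.1) k ?_
    simpa only [h.map_add] using hk

theorem le_iff (h : IsReflecting φ) {a b c d : GoodSeq L} :
    (∃ k, a + d + k ≤ b + c + k) ↔ ∃ k, φ a + φ d + φ k ≤ φ b + φ c + φ k := by
  constructor
  · rintro ⟨k, hk⟩
    refine ⟨k, ?_⟩
    simpa only [h.map_add] using h.mono hk
  · rintro ⟨k, hk⟩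
    refine h.reflect_le (a + d) (b + c) k ?_
    simpa only [h.map_add] using hk

theorem equivalence (h : IsReflecting φ) : Equivalence (ChangRel L) where
  refl x := h.rel_iff.2 ⟨0, by rw [add_comm (φ x.1)]⟩
  symm := by
    intro x y hxy
    obtain ⟨k, hk⟩ := h.rel_iff.1 hxy
    refine h.rel_iff.2 ⟨k, ?_⟩
    rw [add_comm (φ y.1), add_comm (φ y.2), hk]
  trans := by
    intro x y z hxy hyz
    obtain ⟨k, hk⟩ := h.rel_iff.1 hxy
    obtain ⟨l, hl⟩ := h.rel_iff.1 hyz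
    -- Adding the two relations leaves the middle pair on both sides, so the witness absorbs it
    -- along with `k` and `l`.
    refine h.rel_iff.2 ⟨y.1 + y.2 + k + l, ?_⟩
    simp only [h.map_add]
    calc φ x.1 + φ z.2 + (φ y.1 + φ y.2 + φ k + φ l)
        = (φ x.1 + φ y.2 + φ k) + (φ y.1 + φ z.2 + φ l) := by abel
      _ = (φ x.2 + φ y.1 + φ k) + (φ y.2 + φ z.1 + φ l) := by rw [hk, hl]
      _ = _ := by abel

theorem mk_eq_mk (h : IsReflecting φ) {a b c d : GoodSeq L} :
    ChangGroup.mk a b = ChangGroup.mk c d ↔ ∃ k, φ a + φ d + φ k = φ b + φ c + φ k :=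
  (Quot.eq.trans h.equivalence.eqvGen_iff).trans (h.rel_iff (x := (a, b)) (y := (c, d)))

/-- The addition of `G_L`. -/
@[reducible] def addition (h : IsReflecting φ) : Add (ChangGroup L) where
  add := Quot.map₂ (fun x y => (x.1 + y.1, x.2 + y.2))
    (fun x y z hyz => by
      obtain ⟨k, hk⟩ := h.rel_iff.1 hyz
      refine h.rel_iff.2 ⟨k, ?_⟩
      simp only [h.map_add]
      calc φ x.1 + φ y.1 + (φ x.2 + φ z.2) + φ k
          = φ x.1 + φ x.2 + (φ y.1 + φ z.2 + φ k) := by abel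
        _ = φ x.1 + φ x.2 + (φ y.2 + φ z.1 + φ k) := by rw [hk]
        _ = _ := by abel)
    (fun x y z hxy => by
      obtain ⟨k, hk⟩ := h.rel_iff.1 hxy
      refine h.rel_iff.2 ⟨k, ?_⟩
      simp only [h.map_add]
      calc φ x.1 + φ z.1 + (φ y.2 + φ z.2) + φ k
          = φ z.1 + φ z.2 + (φ x.1 + φ y.2 + φ k) := by abel
        _ = φ z.1 + φ z.2 + (φ x.2 + φ y.1 + φ k) := by rw [hk]
        _ = _ := by abel)

/-- The negation of `G_L`. -/
@[reducible] def negation (h : IsReflecting φ) : Neg (ChangGroup L) where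
  neg := Quot.map (fun x => (x.2, x.1)) (fun x y hxy => by
    obtain ⟨k, hk⟩ := h.rel_iff.1 hxy
    exact h.rel_iff.2 ⟨k, hk.symm⟩)

/-- The group `G_L`. -/
@[reducible] def addCommGroup (h : IsReflecting φ) : AddCommGroup (ChangGroup L) :=
  letI := h.addition
  letI := h.negation
  letI : Zero (ChangGroup L) := ⟨ChangGroup.mk 0 0⟩
  -- After applying `φ` each law is an identity of commutative monoids, so the witness `0` always
  -- works.
  { AddGroup.ofLeftAxioms (G := ChangGroup L)
      (by
          rintro ⟨a, b⟩ ⟨c, d⟩ ⟨e, f⟩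
          refine h.mk_eq_mk.2 ⟨0, ?_⟩
          simp only [h.map_add]
          abel)
      (by
          rintro ⟨a, b⟩
          refine h.mk_eq_mk.2 ⟨0, ?_⟩
          simp only [h.map_add, h.map_zero]
          abel)
      (by
          rintro ⟨a, b⟩
          refine h.mk_eq_mk.2 ⟨0, ?_⟩
          simp only [h.map_add, h.map_zero]
          abel) with
    add_comm := (by
          rintro ⟨a, b⟩ ⟨c, d⟩
          refine h.mk_eq_mk.2 ⟨0, ?_⟩
          simp only [h.map_add]
          abel) }

variable [IsOrderedAddMonoid N]

/-- The order of `G_L`. -/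
@[reducible] def partialOrder (h : IsReflecting φ) : PartialOrder (ChangGroup L) where
  -- Asking for some representatives avoids lifting the relation to the quotient; `mk_le_mk_iff`
  -- shows that the choice is immaterial.
  le p q := ∃ a b c d, p = ChangGroup.mk a b ∧ q = ChangGroup.mk c d ∧
    ∃ k, φ a + φ d + φ k ≤ φ b + φ c + φ k
  le_refl := by
    rintro ⟨a, b⟩
    exact ⟨a, b, a, b, rfl, rfl, 0, by rw [add_comm (φ a)]⟩
  le_trans := by
    rintro p q r ⟨a, b, c, d, rfl, rfl, k, hk⟩ ⟨c', d', e, f, hq, rfl, l, hl⟩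
    obtain ⟨m, hm⟩ := h.mk_eq_mk.1 hq
    refine ⟨a, b, e, f, rfl, rfl, c + d' + d + c' + k + l + m, ?_⟩
    simp only [h.map_add]
    calc φ a + φ f + (φ c + φ d' + φ d + φ c' + φ k + φ l + φ m)
        = (φ a + φ d + φ k) + (φ c' + φ f + φ l) + (φ c + φ d' + φ m) := by abel
      _ ≤ (φ b + φ c + φ k) + (φ d' + φ e + φ l) + (φ c + φ d' + φ m) :=
          add_le_add_left (add_le_add hk hl) _
      _ = (φ b + φ c + φ k) + (φ d' + φ e + φ l) + (φ d + φ c' + φ m) := by rw [hm]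
      _ = _ := by abel
  le_antisymm := by
    rintro p q ⟨a, b, c, d, rfl, rfl, k, hk⟩ ⟨c', d', a', b', hq, hp, l, hl⟩
    obtain ⟨m, hm⟩ := h.mk_eq_mk.1 hq
    obtain ⟨n, hn⟩ := h.mk_eq_mk.1 hp
    -- Antisymmetry is taken from `N`, so one witness must be large enough for both inequalities and
    -- both changes of representatives.
    refine h.mk_eq_mk.2 ⟨a' + b' + c' + d' + k + l + m + n, le_antisymm ?_ ?_⟩
    · simp only [h.map_add]
      calc φ a + φ d + (φ a' + φ b' + φ c' + φ d' + φ k + φ l + φ m + φ n)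
          = (φ a + φ d + φ k) + (φ a' + φ b' + φ c' + φ d' + φ l + φ m + φ n) := by abel
        _ ≤ (φ b + φ c + φ k) + (φ a' + φ b' + φ c' + φ d' + φ l + φ m + φ n) :=
            add_le_add_left hk _
        _ = _ := by abel
    · simp only [h.map_add]
      calc φ b + φ c + (φ a' + φ b' + φ c' + φ d' + φ k + φ l + φ m + φ n)
          = (φ c' + φ b' + φ l) + (φ b + φ a' + φ n) + (φ c + φ d' + φ m) + φ k := by abel
        _ ≤ (φ d' + φ a' + φ l) + (φ b + φ a' + φ n) + (φ c + φ d' + φ m) + φ k :=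
            add_le_add_left (add_le_add_left (add_le_add_left hl _) _) _
        _ = (φ d' + φ a' + φ l) + (φ a + φ b' + φ n) + (φ d + φ c' + φ m) + φ k := by
            rw [hn, hm]
        _ = _ := by abel

theorem mk_le_mk_iff (h : IsReflecting φ) {a b c d : GoodSeq L} :
    h.partialOrder.le (ChangGroup.mk a b) (ChangGroup.mk c d) ↔
      ∃ k, φ a + φ d + φ k ≤ φ b + φ c + φ k := by
  constructor
  · rintro ⟨a', b', c', d', hp, hq, k, hk⟩
    obtain ⟨m, hm⟩ := h.mk_eq_mk.1 hp
    obtain ⟨n, hn⟩ := h.mk_eq_mk.1 hq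
    refine ⟨a' + b' + c' + d' + k + m + n, ?_⟩
    simp only [h.map_add]
    calc φ a + φ d + (φ a' + φ b' + φ c' + φ d' + φ k + φ m + φ n)
        = (φ a' + φ d' + φ k) + (φ a + φ b' + φ m) + (φ d + φ c' + φ n) := by abel
      _ ≤ (φ b' + φ c' + φ k) + (φ a + φ b' + φ m) + (φ d + φ c' + φ n) :=
          add_le_add_left (add_le_add_left hk _) _
      _ = (φ b' + φ c' + φ k) + (φ b + φ a' + φ m) + (φ c + φ d' + φ n) := by rw [hm, hn]
      _ = _ := by abel
  · rintro ⟨k, hk⟩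
    exact ⟨a, b, c, d, rfl, rfl, k, hk⟩

theorem isChangStructure (h : IsReflecting φ) :
    @IsChangStructure L _ h.addCommGroup h.partialOrder := by
  let _ := h.addCommGroup
  let _ := h.partialOrder
  exact ⟨fun _ _ _ _ => rfl, rfl, fun _ _ => rfl,
    fun _ _ _ _ => h.mk_le_mk_iff.trans h.le_iff.symm⟩

theorem isOrderedAddMonoid (h : IsReflecting φ) :
    @IsOrderedAddMonoid _ h.addCommGroup.toAddCommMonoid h.partialOrder.toPreorder := by
  let _ := h.addCommGroup
  let _ := h.partialOrder
  have key : ∀ p q r : ChangGroup L, p ≤ q → p + r ≤ q + r := by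
    rintro ⟨a, b⟩ ⟨c, d⟩ ⟨e, f⟩ hpq
    obtain ⟨k, hk⟩ := h.mk_le_mk_iff.1 hpq
    refine h.mk_le_mk_iff.2 ⟨k, ?_⟩
    simp only [h.map_add]
    calc φ a + φ e + (φ d + φ f) + φ k = (φ a + φ d + φ k) + (φ e + φ f) := by abel
      _ ≤ (φ b + φ c + φ k) + (φ e + φ f) := add_le_add_left hk _
      _ = _ := by abel
  exact { add_le_add_left := fun p q hpq r => key p q r hpq }

theorem isPoGroup (h : IsReflecting φ) : IsPoGroup L :=
  ⟨h.equivalence, h.addCommGroup, h.partialOrder, h.isChangStructure, h.isOrderedAddMonoid⟩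

theorem isOGroup (h : IsReflecting φ) (htot : ∀ a b, φ a ≤ φ b ∨ φ b ≤ φ a) : IsOGroup L := by
  refine ⟨h.equivalence, h.addCommGroup, h.partialOrder, h.isChangStructure,
    h.isOrderedAddMonoid, ?_⟩
  rintro ⟨a, b⟩ ⟨c, d⟩
  rcases htot (a + d) (b + c) with hle | hle <;> rw [h.map_add, h.map_add] at hle
  · exact Or.inl (h.mk_le_mk_iff.2 ⟨0, add_le_add_left hle _⟩)
  · refine Or.inr (h.mk_le_mk_iff.2 ⟨0, ?_⟩)
    rw [add_comm (φ c), add_comm (φ d)]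
    exact add_le_add_left hle _

end IsReflecting

end ChangGroup

/-! ### Arithmetic behind associativity and cancellation. -/

namespace BLAlgebra

variable {L : Type u} [BLAlgebra L]

theorem add_mono {x x' y y' : L} (hx : x ≤ x') (hy : y ≤ y') : x + y ≤ x' + y' := by
  rw [add_def, add_def]
  refine inf_le_inf ?_ ?_
  · exact (himp_le_himp_r (compl_anti hx) _).trans (himp_le_himp_l hy _)
  · exact (himp_le_himp_r (compl_anti hy) _).trans (himp_le_himp_l hx _)

theorem mul_mono {x x' y y' : L} (hx : x ≤ x') (hy : y ≤ y') : x * y ≤ x' * y' := by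
  refine (mul_le_mul_l hx y).trans ?_
  rw [mul_comm x' y, mul_comm x' y']
  exact mul_le_mul_l hy x'

theorem badd_one (x : L) : x + 1 = 1 := by rw [badd_comm, one_badd]

theorem le_compl_of_mul_eq_zero {x y : L} (h : x * y = 0) : x ≤ yᶜ := by
  rw [compl_def, ← mul_le_iff, h]

theorem compl_le_of_add_eq_one {x y : L} (h : x + y = 1) : xᶜ ≤ y :=
  le_def.2 (le_antisymm (le_one _) (h.ge.trans inf_le_left))

theorem add_eq_one_or_mul_eq_zero (hL : IsBLChain L) (x y : L) : x + y = 1 ∨ x * y = 0 := by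
  by_cases h : x * y = 0
  · exact Or.inr h
  · exact Or.inl (chain_add_eq_one hL h)

theorem mul_himp_of_le {x y : L} (h : y ≤ x) : x * (x ⇨ y) = y := by
  rw [← inf_def, inf_eq_right.2 h]

/-! ### Regular elements -/

theorem regular_add_eq_himp {x y : L} (hx : xᶜᶜ = x) (hy : yᶜᶜ = y) : x + y = xᶜ ⇨ y := by
  rw [regular_add hx hy, ← himp_compl, hy]

theorem regular_add_regular {x y : L} (hx : xᶜᶜ = x) (hy : yᶜᶜ = y) : (x + y)ᶜᶜ = x + y := by
  rw [regular_add hx hy, compl3]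

theorem compl_regular_mul {x y : L} (hx : xᶜᶜ = x) (hy : yᶜᶜ = y) : (x * y)ᶜ = xᶜ + yᶜ := by
  rw [regular_add (compl3 x) (compl3 y), hx, hy]

theorem one_compl_compl : (1 : L)ᶜᶜ = 1 := by rw [one_compl, zero_compl]

/-- A dense product would give `xᶜ + yᶜ = 0`, hence `x = y = 1`, whose product is regular anyway. -/
theorem regular_mul_regular (hL : IsBLChain L) {x y : L} (hx : xᶜᶜ = x) (hy : yᶜᶜ = y) :
    (x * y)ᶜᶜ = x * y := by
  rcases regular_or_dense hL (x * y) with h | h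
  · exact h
  · rw [compl_regular_mul hx hy] at h
    have hx1 : x = 1 := by rw [← hx, chain_add_eq_zero h, zero_compl]
    have hy1 : y = 1 := by
      rw [badd_comm] at h
      rw [← hy, chain_add_eq_zero h, zero_compl]
    rw [hx1, hy1, one_mul, one_compl_compl]

/-- By residuation `a * (a * b)ᶜ = a ⊓ bᶜ = bᶜ`; complementing gives the claim. It recovers a factor
from a product. -/
theorem himp_mul_cancel {a b : L} (ha : aᶜᶜ = a) (hb : bᶜᶜ = b) (hab : (a * b)ᶜᶜ = a * b)
    (h : aᶜ ≤ b) : a ⇨ a * b = b := by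
  have h1 : a * (a * b)ᶜ = bᶜ := by
    rw [← himp_compl]
    refine mul_himp_of_le ?_
    rw [← ha]
    exact compl_anti h
  rw [← hab, himp_compl, h1, hb]

/-- The identities behind associativity of the addition of good sequences with terms in `S`. -/
structure IsAssocSet (S : Set L) : Prop where
  low : ∀ x ∈ S, ∀ y ∈ S, ∀ z ∈ S, x * y = 0 → y * z = 0 → (x + y) * z = x * (y + z)
  high : ∀ x ∈ S, ∀ y ∈ S, ∀ z ∈ S, x + y = 1 → y + z = 1 → x * y + z = x + y * z
  mixed : ∀ x ∈ S, ∀ y ∈ S, ∀ z ∈ S, x + y = 1 → y * z = 0 → x * y + z = x * (y + z)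

/-- Cancellation for pairs of sums and products of elements of `S`. -/
def IsCancelSet (S : Set L) : Prop :=
  ∀ x ∈ S, ∀ y ∈ S, ∀ z ∈ S, x + z = y + z → x * z = y * z → x = y

/-- Both `x` and `z` lie below `yᶜ`, so by divisibility each side equals `yᶜ * (yᶜ ⇨ x) * (yᶜ ⇨ z)`.
-/
theorem regular_low {x y z : L} (hx : xᶜᶜ = x) (hy : yᶜᶜ = y) (hz : zᶜᶜ = z)
    (hxy : x * y = 0) (hyz : y * z = 0) : (x + y) * z = x * (y + z) := by
  have h1 : yᶜ * (yᶜ ⇨ x) = x := mul_himp_of_le (le_compl_of_mul_eq_zero hxy)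
  have h2 : yᶜ * (yᶜ ⇨ z) = z :=
    mul_himp_of_le (le_compl_of_mul_eq_zero (by rw [mul_comm, hyz]))
  rw [badd_comm x y, regular_add_eq_himp hy hx, regular_add_eq_himp hy hz]
  calc (yᶜ ⇨ x) * z = (yᶜ ⇨ x) * (yᶜ * (yᶜ ⇨ z)) := by rw [h2]
    _ = yᶜ * (yᶜ ⇨ x) * (yᶜ ⇨ z) := by rw [mul_left_comm, mul_assoc]
    _ = x * (yᶜ ⇨ z) := by rw [h1]

theorem regular_compl_mul_compl {x y : L} (hy : yᶜᶜ = y) (h : x + y = 1) :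
    xᶜ * yᶜ = 0 := by
  refine eq_zero_of_le (mul_le_iff.2 ?_)
  rw [← compl_def, hy]
  exact compl_le_of_add_eq_one h

theorem isAssocSet_regular (hL : IsBLChain L) : IsAssocSet {x : L | xᶜᶜ = x} where
  low := fun x hx y hy z hz => regular_low hx hy hz
  high := by
    intro x hx y hy z hz hxy hyz
    rw [Set.mem_ofPred_eq] at hx hy hz
    -- De Morgan duality: `high` is `low` for the complements, complemented.
    have h := regular_low (compl3 x) (compl3 y) (compl3 z) (regular_compl_mul_compl hy hxy)
      (regular_compl_mul_compl hz hyz)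
    have h' := congrArg (·ᶜ) h
    rw [← compl_regular_mul hx hy, ← compl_regular_mul hy hz,
      compl_regular_mul (compl3 _) (compl3 _), compl_regular_mul (compl3 _) (compl3 _),
      regular_mul_regular hL hx hy, regular_mul_regular hL hy hz, hx, hz] at h'
    exact h'
  mixed := by
    intro x hx y hy z hz hxy hyz
    rw [Set.mem_ofPred_eq] at hx hy hz
    have hyx : yᶜ ≤ x := compl_le_of_add_eq_one (by rw [badd_comm, hxy])
    have hzy : z ≤ yᶜ := le_compl_of_mul_eq_zero (by rw [mul_comm, hyz])
    -- With `a = (x * y)ᶜ` and `b = x * (y + z)` this reads `a * b = z`, so the left side of the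
    -- goal is `a ⇨ a * b`, and `himp_mul_cancel` applies.
    have hprod : (x * y)ᶜ * (x * (y + z)) = z := by
      rw [← himp_compl, ← mul_assoc, mul_comm _ x, mul_himp_of_le hyx,
        regular_add_eq_himp hy hz, mul_himp_of_le hzy]
    rw [regular_add_eq_himp (regular_mul_regular hL hx hy) hz]
    conv_lhs => rw [← hprod]
    refine himp_mul_cancel (compl3 _)
      (regular_mul_regular hL hx (regular_add_regular hy hz)) (by rw [hprod, hz]) ?_
    rw [regular_mul_regular hL hx hy]
    exact mul_mono le_rfl (le_badd_left y z)

/-- If `x * z = 0`, the sum determines `x`, as `x = zᶜ * (z + x)`. Otherwise `x + z = 1` and the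
product does, as `x = z ⇨ z * x`. -/
theorem isCancelSet_regular (hL : IsBLChain L) : IsCancelSet {x : L | xᶜᶜ = x} := by
  intro x hx y hy z hz hadd hmul
  rw [Set.mem_ofPred_eq] at hx hy hz
  by_cases h0 : x * z = 0
  · have h1 := mul_himp_of_le (le_compl_of_mul_eq_zero h0)
    have h2 := mul_himp_of_le (le_compl_of_mul_eq_zero (hmul ▸ h0))
    rw [← regular_add_eq_himp hz hx, badd_comm] at h1
    rw [← regular_add_eq_himp hz hy, badd_comm] at h2
    rw [← h1, hadd, h2]
  · have h1 := chain_add_eq_one hL h0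
    have key : ∀ t : L, tᶜᶜ = t → t + z = 1 → z ⇨ z * t = t := fun t ht h =>
      himp_mul_cancel hz ht (regular_mul_regular hL hz ht)
        (compl_le_of_add_eq_one (by rw [badd_comm, h]))
    rw [← key x hx h1, ← key y hy (hadd ▸ h1), mul_comm z, hmul, mul_comm z]

/-! ### Chains in which all nonzero elements are dense -/

theorem dense_mul_eq_zero (hd : ∀ x : L, x ≠ 0 → xᶜ = 0) {x y : L} (h : x * y = 0) :
    x = 0 ∨ y = 0 := by
  by_cases hy : y = 0
  · exact Or.inr hy
  · left
    have := le_compl_of_mul_eq_zero h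
    rw [hd y hy] at this
    exact eq_zero_of_le this

/-- There are no zero divisors and nonzero elements add up to `1`, so only cases with a zero entry
need attention. -/
theorem isAssocSet_dense (hL : IsBLChain L) (hd : ∀ x : L, x ≠ 0 → xᶜ = 0) :
    IsAssocSet (Set.univ : Set L) where
  low := by
    intro x _ y _ z _ hxy hyz
    by_cases hy : y = 0
    · rw [hy, add_zero, zero_add]
    · rw [(dense_mul_eq_zero hd hxy).resolve_right hy, (dense_mul_eq_zero hd hyz).resolve_left hy,
        mul_zero', zero_mul']
  high := by
    intro x _ y _ z _ hxy hyz
    by_cases hx : x = 0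
    · rw [hx, zero_add] at hxy
      rw [hx, hxy, zero_add, zero_mul', one_mul, zero_add]
    by_cases hy : y = 0
    · rw [hy, add_zero] at hxy
      rw [hy, zero_add] at hyz
      rw [hxy, hyz, one_badd, badd_one]
    by_cases hz : z = 0
    · rw [hz, add_zero] at hyz
      rw [hz, hyz, mul_zero', mul_one, add_zero]
    have hxy0 : x * y ≠ 0 := fun h => (dense_mul_eq_zero hd h).elim hx hy
    rw [dense_add hL (hd _ hxy0) hz]
    exact (dense_add hL (hd _ hx) fun h => (dense_mul_eq_zero hd h).elim hy hz).symm
  mixed := by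
    intro x _ y _ z _ hxy hyz
    rcases dense_mul_eq_zero hd hyz with h | h
    · rw [h, add_zero] at hxy
      rw [h, hxy, mul_zero', zero_add, one_mul]
    · rw [h, add_zero, add_zero]

end BLAlgebra

/-! ### Addition of stairs. -/

section SeqAdd

variable {L : Type u} [BLAlgebra L]

theorem seqAdd_comm (a b : ℕ → L) : seqAdd a b = seqAdd b a := by
  funext i
  rw [seqAdd_eq, seqAdd_eq, ← Finset.Nat.sum_antidiagonal_swap]
  exact Finset.sum_congr rfl fun p _ => mul_comm _ _

theorem zero_seqAdd (a : ℕ → L) : seqAdd (fun _ => 0) a = a := by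
  funext i
  rw [seqAdd, Finset.sum_eq_zero fun j _ => zero_mul' _, zero_add, zero_add]

theorem sum_mono {ι : Type*} (s : Finset ι) {f g : ι → L} (h : ∀ i ∈ s, f i ≤ g i) :
    ∑ i ∈ s, f i ≤ ∑ i ∈ s, g i := by
  classical
  induction s using Finset.induction_on with
  | empty => rfl
  | insert a s ha ih =>
    rw [Finset.sum_insert ha, Finset.sum_insert ha]
    exact add_mono (h a (Finset.mem_insert_self _ _))
      (ih fun i hi => h i (Finset.mem_insert_of_mem hi))

theorem seqAdd_mono {a a' b b' : ℕ → L} (ha : a ≤ a') (hb : b ≤ b') :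
    seqAdd a b ≤ seqAdd a' b' := fun i =>
  add_mono (add_mono (ha i) (sum_mono _ fun _ _ => mul_mono (ha _) (hb _))) (hb i)

/-- The sequence `(1, …, 1, x, 0, 0, …)` with `m` leading ones. -/
def stair (m : ℕ) (x : L) (i : ℕ) : L := if i < m then 1 else if i = m then x else 0

/-- The sequence `(1, …, 1, x, y, 0, 0, …)` with `m` leading ones. -/
def stair₂ (m : ℕ) (x y : L) (i : ℕ) : L :=
  if i < m then 1 else if i = m then x else if i = m + 1 then y else 0

theorem stair_of_lt {m i : ℕ} (h : i < m) (x : L) : stair m x i = 1 := if_pos h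

theorem stair_self (m : ℕ) (x : L) : stair m x m = x := by simp [stair]

theorem stair_of_gt {m i : ℕ} (h : m < i) (x : L) : stair m x i = 0 := by
  rw [stair, if_neg (by omega), if_neg (by omega)]

theorem stair₂_one (m : ℕ) (y : L) : stair₂ m 1 y = stair (m + 1) y := by
  funext i
  unfold stair stair₂
  split_ifs <;> first | rfl | omega

theorem stair₂_zero (m : ℕ) (x : L) : stair₂ m x 0 = stair m x := by
  funext i
  unfold stair stair₂
  split_ifs <;> rfl

theorem seqCons_stair (m : ℕ) (x : L) : seqCons (stair m x) = stair (m + 1) x := by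
  funext i
  cases i with
  | zero => simp [seqCons, stair]
  | succ i => simp [seqCons, stair]

/-- By `seqAdd_eq` the sum is a convolution of the sequences preceded by `1`, hence of stairs with
`m + 1` and `n + 1` ones. -/
theorem stair_seqAdd (m n : ℕ) (x y : L) :
    seqAdd (stair m x) (stair n y) = stair₂ (m + n) (x + y) (x * y) := by
  funext i
  rw [seqAdd_eq, seqCons_stair, seqCons_stair]
  rcases lt_trichotomy i (m + n) with h | h | h
  · rw [stair₂, if_pos h]
    refine le_antisymm (le_one _) (le_trans (le_of_eq ?_) (le_sum _
      (fun p : ℕ × ℕ => stair (m + 1) x p.1 * stair (n + 1) y p.2)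
      -- Since `i + 1 ≤ m + n`, this index pair falls on ones of both stairs, and one summand `1`
      -- forces the sum to be `1`.
      (i := (min m (i + 1), i + 1 - min m (i + 1))) ?_))
    · simp only
      rw [stair_of_lt (by omega), stair_of_lt (by omega), one_mul]
    · rw [Finset.HasAntidiagonal.mem_antidiagonal]
      simp only
      omega
  -- On the antidiagonal `m + n + 1` only the two pairs pairing a last entry with a one survive.
  · rw [stair₂, if_neg (by omega), if_pos h,
      Finset.sum_eq_add (m + 1, n) (m, n + 1) (by simp)]
    · simp only
      rw [stair_self, stair_self, stair_of_lt (by omega), stair_of_lt (by omega), one_mul, mul_one]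
    · rintro ⟨p, q⟩ hp hne
      rw [Finset.HasAntidiagonal.mem_antidiagonal] at hp
      simp only [ne_eq, Prod.mk.injEq] at hp hne ⊢
      rcases lt_or_ge (m + 1) p with h' | h'
      · rw [stair_of_gt h', zero_mul']
      · rw [stair_of_gt (m := n + 1) (by omega), mul_zero']
    · intro hn
      exact absurd (Finset.HasAntidiagonal.mem_antidiagonal.2 (by simp only; omega)) hn
    · intro hn
      exact absurd (Finset.HasAntidiagonal.mem_antidiagonal.2 (by simp only; omega)) hn
  · have hz : ∀ p ∈ Finset.HasAntidiagonal.antidiagonal (i + 1), p ≠ (m + 1, n + 1) →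
        stair (m + 1) x p.1 * stair (n + 1) y p.2 = 0 := by
      rintro ⟨p, q⟩ hp hne
      rw [Finset.HasAntidiagonal.mem_antidiagonal] at hp
      simp only [ne_eq, Prod.mk.injEq] at hp hne ⊢
      rcases lt_or_ge (m + 1) p with h' | h'
      · rw [stair_of_gt h', zero_mul']
      · rw [stair_of_gt (m := n + 1) (by omega), mul_zero']
    by_cases h1 : i = m + n + 1
    · rw [stair₂, if_neg (by omega), if_neg (by omega), if_pos h1,
        Finset.sum_eq_single (m + 1, n + 1) hz]
      · simp only
        rw [stair_self, stair_self]
      · intro hn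
        exact absurd (Finset.HasAntidiagonal.mem_antidiagonal.2 (by simp only; omega)) hn
    · rw [stair₂, if_neg (by omega), if_neg (by omega), if_neg h1]
      refine Finset.sum_eq_zero fun p hp => hz p hp ?_
      rintro rfl
      rw [Finset.HasAntidiagonal.mem_antidiagonal] at hp
      simp only at hp
      omega

theorem stair_seqAdd_of_add {m n : ℕ} {x y : L} (h : x + y = 1) :
    seqAdd (stair m x) (stair n y) = stair (m + n + 1) (x * y) := by
  rw [stair_seqAdd, h, stair₂_one]

theorem stair_seqAdd_of_mul {m n : ℕ} {x y : L} (h : x * y = 0) :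
    seqAdd (stair m x) (stair n y) = stair (m + n) (x + y) := by
  rw [stair_seqAdd, h, stair₂_zero]

/-- In each of the four cases at least one partial sum collapses to a single stair, leaving one of
the identities of `IsAssocSet`. -/
theorem stair_seqAdd_assoc (hL : IsBLChain L) {S : Set L} (hS : IsAssocSet S) {x y z : L}
    (hx : x ∈ S) (hy : y ∈ S) (hz : z ∈ S) (m n p : ℕ) :
    seqAdd (seqAdd (stair m x) (stair n y)) (stair p z) =
      seqAdd (stair m x) (seqAdd (stair n y) (stair p z)) := by
  rcases add_eq_one_or_mul_eq_zero hL x y with h1 | h1 <;>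
    rcases add_eq_one_or_mul_eq_zero hL y z with h2 | h2
  · rw [stair_seqAdd_of_add h1, stair_seqAdd_of_add h2, stair_seqAdd, stair_seqAdd,
      hS.high x hx y hy z hz h1 h2, mul_assoc]
    congr 1
    omega
  · rw [stair_seqAdd_of_add h1, stair_seqAdd_of_mul h2,
      stair_seqAdd_of_mul (by rw [mul_assoc, h2, mul_zero']),
      stair_seqAdd_of_add (by rw [← add_assoc, h1, one_badd]), hS.mixed x hx y hy z hz h1 h2]
    congr 1
    omega
  -- This case is the mirror image of `mixed`, with `x` and `z` exchanged by commutativity.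
  · rw [stair_seqAdd_of_mul h1, stair_seqAdd_of_add h2,
      stair_seqAdd_of_add (by rw [add_assoc, h2, badd_one]),
      stair_seqAdd_of_mul (by rw [← mul_assoc, h1, zero_mul']), mul_comm, add_comm x, add_comm x,
      mul_comm y, hS.mixed z hz y hy x hx (by rw [add_comm, h2]) (by rw [mul_comm, h1])]
    congr 1
    omega
  · rw [stair_seqAdd_of_mul h1, stair_seqAdd_of_mul h2, stair_seqAdd, stair_seqAdd,
      hS.low x hx y hy z hz h1 h2, add_assoc, add_assoc]

/-- Equality would make `x + z = 1`. If `n = m + 1`, then also `x * z = y + z`, which forces `y + z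
= z`, so `z = 1` or `y = 0`; either way `x = 1`. If `n > m + 1`, then `x * z = 1`. -/
theorem stair_seqAdd_ne (hL : IsBLChain L) {S : Set L} (h1 : (1 : L) ∈ S) (hS : IsCancelSet S)
    {x y z : L} (hx : x ∈ S) (hz : z ∈ S) (hx1 : x ≠ 1) {m n p : ℕ} (hmn : m < n) :
    seqAdd (stair m x) (stair p z) ≠ seqAdd (stair n y) (stair p z) := by
  intro h
  rw [stair_seqAdd, stair_seqAdd] at h
  have e1 := congrFun h (m + p)
  rw [stair₂, stair₂, if_neg (lt_irrefl _), if_pos rfl, if_pos (by omega)] at e1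
  have e2 := congrFun h (m + p + 1)
  rw [stair₂, stair₂, if_neg (by omega), if_neg (by omega), if_pos rfl] at e2
  by_cases hn : n = m + 1
  · rw [if_neg (by omega), if_pos (by omega)] at e2
    have hyz : z + y = z := by
      refine le_antisymm ?_ (le_badd_left z y)
      rw [add_comm, ← e2]
      exact mul_le_r x z
    rw [add_comm, hyz] at e2
    rcases (chain_add_eq_self hL).1 hyz with h' | h'
    · rw [h', mul_one] at e2
      exact hx1 e2
    · exact hx1 (hS x hx 1 h1 z hz (by rw [e1, one_badd]) (by rw [e2, one_mul]))
  · rw [if_pos (by omega)] at e2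
    exact hx1 (le_antisymm (le_one x) (e2 ▸ mul_le_l x z))

theorem stair_seqAdd_cancel (hL : IsBLChain L) {S : Set L} (h1 : (1 : L) ∈ S)
    (hS : IsCancelSet S) {x y z : L} (hx : x ∈ S) (hy : y ∈ S) (hz : z ∈ S) (hx1 : x ≠ 1)
    (hy1 : y ≠ 1) {m n p : ℕ}
    (h : seqAdd (stair m x) (stair p z) = seqAdd (stair n y) (stair p z)) :
    stair m x = stair n y := by
  rcases lt_trichotomy m n with hmn | rfl | hmn
  · exact absurd h (stair_seqAdd_ne hL h1 hS hx hz hx1 hmn)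
  · rw [stair_seqAdd, stair_seqAdd] at h
    have e1 := congrFun h (m + p)
    have e2 := congrFun h (m + p + 1)
    rw [stair₂, stair₂, if_neg (lt_irrefl _), if_pos rfl, if_neg (lt_irrefl _), if_pos rfl] at e1
    rw [stair₂, stair₂, if_neg (by omega), if_neg (by omega), if_pos rfl, if_neg (by omega),
      if_neg (by omega), if_pos rfl] at e2
    rw [hS x hx y hy z hz e1 e2]
  · exact absurd h.symm (stair_seqAdd_ne hL h1 hS hy hz hy1 hmn)

end SeqAdd

/-- A good sequence in a chain is a stair. -/
theorem IsGoodSeq.eq_stair {L : Type u} [BLAlgebra L] (hL : IsBLChain L) {a : ℕ → L}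
    (ha : IsGoodSeq a) : ∃ m, a = stair m (a m) ∧ ((1 : L) ≠ 0 → a m ≠ 1) := by
  classical
  by_cases hone : ∃ n, a n ≠ 1
  · refine ⟨Nat.find hone, ?_, fun _ => Nat.find_spec hone⟩
    have hlt : ∀ i < Nat.find hone, a i = 1 := fun i hi => not_not.1 (Nat.find_min hone hi)
    have hgt : ∀ j, a (Nat.find hone + 1 + j) = 0 := by
      intro j
      induction j with
      | zero => exact ((chain_add_eq_self hL).1 (ha.add_eq _)).resolve_left (Nat.find_spec hone)
      | succ j ih =>
        have := ha.add_eq (Nat.find hone + 1 + j)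
        rwa [ih, zero_add] at this
    funext i
    rcases lt_trichotomy i (Nat.find hone) with h | h | h
    · rw [stair_of_lt h, hlt i h]
    · rw [h, stair_self]
    · rw [stair_of_gt h]
      obtain ⟨j, rfl⟩ := Nat.exists_eq_add_of_lt h
      rw [← hgt j]
      congr 1
      omega
  -- A good sequence ends in zeros, so this happens only in the trivial algebra.
  · have hall : ∀ n, a n = 1 := fun n => not_not.1 fun h => hone ⟨n, h⟩
    obtain ⟨n, hn⟩ := ha.eventually_zero
    have h10 : (1 : L) = 0 := by rw [← hall n, hn n le_rfl]
    refine ⟨0, ?_, fun h => absurd h10 h⟩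
    have hs : ∀ x : L, x = 0 := fun x => eq_zero_of_le (h10 ▸ le_one x)
    funext i
    rw [hs (a i), hs (stair _ _ _)]

theorem stair_le_stair {L : Type u} [BLAlgebra L] {m n : ℕ} (h : m < n) (x y : L) :
    stair m x ≤ stair n y := by
  intro i
  rcases lt_or_ge i n with h' | h'
  · rw [stair_of_lt h']
    exact le_one _
  · rw [stair_of_gt (h.trans_le h')]
    exact bot_le' _

theorem stair_mono {L : Type u} [BLAlgebra L] (m : ℕ) {x y : L} (h : x ≤ y) :
    stair m x ≤ stair m y := by
  intro i
  unfold stair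
  split_ifs
  exacts [le_rfl, h, le_rfl]

/-! ### Order, associativity and cancellation in `M_L`. -/

namespace GoodSeq

variable {L : Type u} [BLAlgebra L]

theorem badd_comm (a b : GoodSeq L) : a + b = b + a := Subtype.ext (seqAdd_comm _ _)

theorem zero_badd (a : GoodSeq L) : 0 + a = a := Subtype.ext (zero_seqAdd _)

theorem badd_zero (a : GoodSeq L) : a + 0 = a := by rw [badd_comm, zero_badd]

theorem add_mono {a a' b b' : GoodSeq L} (ha : a ≤ a') (hb : b ≤ b') : a + b ≤ a' + b' :=
  seqAdd_mono (L := L) ha hb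

/-- The image of a good sequence under a homomorphism. -/
def map {M : Type v} [BLAlgebra M] (f : BLHom L M) (a : GoodSeq L) : GoodSeq M :=
  ⟨fun i => f.toFun (a.1 i),
    fun i => by rw [← f.map_add, a.2.add_eq], by
      obtain ⟨n, hn⟩ := a.2.eventually_zero
      exact ⟨n, fun r hr => by rw [hn r hr, f.map_zero']⟩⟩

theorem map_add {M : Type v} [BLAlgebra M] (f : BLHom L M) (a b : GoodSeq L) :
    (a + b).map f = a.map f + b.map f :=
  Subtype.ext (funext fun i => f.map_seqAdd a.1 b.1 i)

theorem map_zero {M : Type v} [BLAlgebra M] (f : BLHom L M) :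
    (0 : GoodSeq L).map f = 0 :=
  Subtype.ext (funext fun _ => f.map_zero')

theorem map_mono {M : Type v} [BLAlgebra M] (f : BLHom L M) : Monotone (map f) := by
  intro a b h i
  change f.toFun (a.1 i) ⇨ f.toFun (b.1 i) = 1
  rw [← f.map_himp', le_def.1 (h i), f.map_one']

/-- The good sequence `(x, 0, 0, …)`. -/
def single (x : L) : GoodSeq L :=
  ⟨stair 0 x, fun i => by rw [stair_of_gt (Nat.succ_pos i), add_zero], 1,
    fun _ hr => stair_of_gt hr x⟩

theorem total (hL : IsBLChain L) (a b : GoodSeq L) : a ≤ b ∨ b ≤ a := by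
  obtain ⟨m, hm, -⟩ := a.2.eq_stair hL
  obtain ⟨n, hn, -⟩ := b.2.eq_stair hL
  change a.1 ≤ b.1 ∨ b.1 ≤ a.1
  rw [hm, hn]
  rcases lt_trichotomy m n with h | rfl | h
  · exact Or.inl (stair_le_stair h _ _)
  · exact (hL (a.1 m) (b.1 m)).imp (stair_mono m) (stair_mono m)
  · exact Or.inr (stair_le_stair h _ _)

theorem assoc_of_isAssocSet (hL : IsBLChain L) {S : Set L} (hS : IsAssocSet S)
    {a b c : GoodSeq L} (ha : ∀ i, a.1 i ∈ S) (hb : ∀ i, b.1 i ∈ S) (hc : ∀ i, c.1 i ∈ S) :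
    a + b + c = a + (b + c) := by
  obtain ⟨m, hm, -⟩ := a.2.eq_stair hL
  obtain ⟨n, hn, -⟩ := b.2.eq_stair hL
  obtain ⟨p, hp, -⟩ := c.2.eq_stair hL
  refine Subtype.ext ?_
  change seqAdd (seqAdd a.1 b.1) c.1 = seqAdd a.1 (seqAdd b.1 c.1)
  rw [hm, hn, hp]
  exact stair_seqAdd_assoc hL hS (ha m) (hb n) (hc p) m n p

theorem cancel_of_isCancelSet (hL : IsBLChain L) {S : Set L} (h1 : (1 : L) ∈ S)
    (hS : IsCancelSet S) {a b c : GoodSeq L} (ha : ∀ i, a.1 i ∈ S) (hb : ∀ i, b.1 i ∈ S)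
    (hc : ∀ i, c.1 i ∈ S) (h : a + c = b + c) : a = b := by
  obtain ⟨m, hm, hm1⟩ := a.2.eq_stair hL
  obtain ⟨n, hn, hn1⟩ := b.2.eq_stair hL
  obtain ⟨p, hp, -⟩ := c.2.eq_stair hL
  refine Subtype.ext ?_
  by_cases h10 : (1 : L) = 0
  · have hs : ∀ x : L, x = 0 := fun x => eq_zero_of_le (h10 ▸ le_one x)
    exact funext fun i => (hs _).trans (hs _).symm
  have h' : seqAdd a.1 c.1 = seqAdd b.1 c.1 := congrArg Subtype.val h
  rw [hm, hn, hp] at h'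
  rw [hm, hn]
  exact stair_seqAdd_cancel hL h1 hS (ha m) (hb n) (hc p) (hm1 h10) (hn1 h10) h'

/-- If instead `b ≤ a`, monotonicity turns the inequality into an equality, which cancels. -/
theorem le_cancel_of_isCancelSet (hL : IsBLChain L) {S : Set L} (h1 : (1 : L) ∈ S)
    (hS : IsCancelSet S) {a b c : GoodSeq L} (ha : ∀ i, a.1 i ∈ S) (hb : ∀ i, b.1 i ∈ S)
    (hc : ∀ i, c.1 i ∈ S) (h : a + c ≤ b + c) : a ≤ b := by
  rcases total hL a b with h' | h'
  · exact h'
  · exact (cancel_of_isCancelSet hL h1 hS ha hb hc (le_antisymm h (add_mono h' le_rfl))).le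

/-- The monoid `M_L` when its addition is associative. -/
@[reducible] def addCommMonoid (h : ∀ a b c : GoodSeq L, a + b + c = a + (b + c)) :
    AddCommMonoid (GoodSeq L) where
  add_assoc := h
  zero_add := zero_badd
  add_zero := badd_zero
  add_comm := badd_comm
  nsmul := nsmulRec

theorem isOrderedAddMonoid (h : ∀ a b c : GoodSeq L, a + b + c = a + (b + c)) :
    @IsOrderedAddMonoid _ (addCommMonoid h) _ := by
  let _ := addCommMonoid h
  exact { add_le_add_left := fun a b hab c => add_mono hab le_rfl }

theorem isReflecting_id (h : ∀ a b c : GoodSeq L, a + b + c = a + (b + c)) :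
    @ChangGroup.IsReflecting L _ _ (addCommMonoid h) _ id := by
  let _ := addCommMonoid h
  exact ⟨fun _ _ => rfl, rfl, monotone_id, fun _ _ k hk => ⟨k, hk⟩, fun _ _ k hk => ⟨k, hk⟩⟩

theorem isPoGroup_of_assoc (h : ∀ a b c : GoodSeq L, a + b + c = a + (b + c)) :
    ChangGroup.IsPoGroup L := by
  let _ := addCommMonoid h
  have := isOrderedAddMonoid h
  exact (isReflecting_id h).isPoGroup

theorem isOGroup_of_assoc (hL : IsBLChain L)
    (h : ∀ a b c : GoodSeq L, a + b + c = a + (b + c)) : ChangGroup.IsOGroup L := by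
  let _ := addCommMonoid h
  have := isOrderedAddMonoid h
  exact (isReflecting_id h).isOGroup (total hL)

end GoodSeq

/-! ### Chains with a regular element other than `0` and `1` -/

namespace BLAlgebra

variable {L : Type u} [BLAlgebra L]

/-- Double complementation as an endomorphism of a chain. -/
def complComplHom (hL : IsBLChain L) : BLHom L L where
  toFun x := xᶜᶜ
  map_mul' x y := by
    rw [← regular_mul_regular hL (compl3 xᶜ) (compl3 yᶜ), compl_compl_mul,
      mul_comm x yᶜᶜ, compl_compl_mul, mul_comm y]
  map_himp' x y := by
    have h1 : xᶜᶜ ⇨ yᶜᶜ = x ⇨ yᶜᶜ := by rw [himp_compl, compl_compl_mul, himp_compl]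
    rw [h1]
    rcases regular_or_dense hL y with h | h
    · conv_lhs => rw [← h, himp_compl, compl3]
      rw [himp_compl]
    -- As `y ≤ x ⇨ y`, density of `y` passes to `x ⇨ y`, and both sides are `1`.
    · rw [h, zero_compl, himp_one]
      have := compl_anti (le_himp x y)
      rw [h] at this
      rw [eq_zero_of_le this, zero_compl]
  map_zero' := by rw [zero_compl, one_compl]
  map_one' := one_compl_compl

variable (L) in
/-- The good sequences of regular elements. -/
abbrev RegularSeq : Type u := {a : GoodSeq L // ∀ i, a.1 i ∈ {x : L | xᶜᶜ = x}}

namespace RegularSeq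

/-- The regularization of a good sequence. -/
def ofGoodSeq (hL : IsBLChain L) (a : GoodSeq L) : RegularSeq L :=
  ⟨a.map (complComplHom hL), fun i => compl3 (a.1 i)ᶜ⟩

theorem ofGoodSeq_val (hL : IsBLChain L) (a : RegularSeq L) : ofGoodSeq hL a.1 = a :=
  Subtype.ext (Subtype.ext (funext a.2))

/-- The monoid of good sequences of regular elements. -/
@[reducible] def addCommMonoid (hL : IsBLChain L) : AddCommMonoid (RegularSeq L) :=
  letI : Add (RegularSeq L) := ⟨fun a b => ⟨a.1 + b.1, by
    -- Regular sequences are the fixed points of an additive map, hence closed under addition.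
    have h := GoodSeq.map_add (complComplHom hL) a.1 b.1
    have ha := congrArg Subtype.val (ofGoodSeq_val hL a)
    have hb := congrArg Subtype.val (ofGoodSeq_val hL b)
    simp only [ofGoodSeq] at ha hb
    rw [ha, hb] at h
    exact fun i => congrFun (congrArg Subtype.val h) i⟩⟩
  letI : Zero (RegularSeq L) := ⟨⟨0, fun _ => (complComplHom hL).map_zero'⟩⟩
  { add_assoc := fun a b c =>
      Subtype.ext (GoodSeq.assoc_of_isAssocSet hL (isAssocSet_regular hL) a.2 b.2 c.2)
    zero_add := fun a => Subtype.ext (GoodSeq.zero_badd a.1)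
    add_zero := fun a => Subtype.ext (GoodSeq.badd_zero a.1)
    add_comm := fun a b => Subtype.ext (GoodSeq.badd_comm a.1 b.1)
    nsmul := nsmulRec }

theorem isOrderedAddMonoid (hL : IsBLChain L) :
    @IsOrderedAddMonoid _ (addCommMonoid hL) _ := by
  let _ := addCommMonoid hL
  exact { add_le_add_left := fun a b hab c => GoodSeq.add_mono (L := L) hab le_rfl }

/-- Only the last entry `x` of the stair can change. If it is dense, then `x + e = 1` and `x * e =
e`, exactly as if `x` were `1 = xᶜᶜ`. -/
theorem add_single (hL : IsBLChain L) {e : L} (he0 : e ≠ 0) (a : GoodSeq L)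
    (h : ∀ d : L, dᶜ = 0 → d * e = e) :
    a + GoodSeq.single e = (ofGoodSeq hL a).1 + GoodSeq.single e := by
  obtain ⟨m, hm, -⟩ := a.2.eq_stair hL
  have hv : (ofGoodSeq hL a).1.1 = stair m (a.1 m)ᶜᶜ := by
    funext i
    change (a.1 i)ᶜᶜ = _
    conv_lhs => rw [hm]
    unfold stair
    split_ifs
    exacts [one_compl_compl, rfl, (complComplHom hL).map_zero']
  refine Subtype.ext ?_
  change seqAdd a.1 (stair 0 e) = seqAdd (ofGoodSeq hL a).1.1 (stair 0 e)
  rw [hv]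
  conv_lhs => rw [hm]
  rcases regular_or_dense hL (a.1 m) with hr | hd
  · rw [hr]
  · rw [hd, zero_compl, stair_seqAdd, stair_seqAdd, dense_add hL hd he0, h _ hd, one_badd, one_mul]

end RegularSeq

/-- Here `x ≤ d`, and `d ⇨ x = (d * xᶜ)ᶜ = xᶜ ⇨ dᶜ = x`, so divisibility gives `x = d * (d ⇨ x) = d
* x`. -/
theorem dense_mul_regular (hL : IsBLChain L) {d x : L} (hd : dᶜ = 0) (hx : xᶜᶜ = x)
    (hx0 : xᶜ ≠ 0) : d * x = x := by
  have hle : x ≤ d := by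
    rcases hL x d with h | h
    · exact h
    · have := compl_anti h
      rw [hd] at this
      exact absurd (eq_zero_of_le this) hx0
  have h1 : d ⇨ x = x := by
    conv_lhs => rw [← hx, himp_compl, mul_comm, ← himp_compl, hd, ← compl_def, hx]
  have h2 := mul_himp_of_le hle
  rwa [h1] at h2

/-- A relation between regularizations cancels to one without `k`; adding `(e)` then transfers it
back to `a` and `b`. -/
theorem isReflecting_ofGoodSeq (hL : IsBLChain L) {e : L} (he0 : e ≠ 0) (he : eᶜ ≠ 0) :
    @ChangGroup.IsReflecting L _ _ (RegularSeq.addCommMonoid hL) _ (RegularSeq.ofGoodSeq hL) := by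
  let _ := RegularSeq.addCommMonoid hL
  have hr := (regular_or_dense hL e).resolve_right he
  have hs := fun a => RegularSeq.add_single hL he0 a fun d hd => dense_mul_regular hL hd hr he
  refine ⟨fun a b => Subtype.ext (GoodSeq.map_add _ a b), Subtype.ext (GoodSeq.map_zero _),
    GoodSeq.map_mono _, fun a b k h => ⟨GoodSeq.single e, ?_⟩,
    fun a b k h => ⟨GoodSeq.single e, ?_⟩⟩
  · rw [hs a, hs b, GoodSeq.cancel_of_isCancelSet hL (S := {x : L | xᶜᶜ = x})
      one_compl_compl (isCancelSet_regular hL)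
      (RegularSeq.ofGoodSeq hL a).2 (RegularSeq.ofGoodSeq hL b).2 (RegularSeq.ofGoodSeq hL k).2
      (congrArg Subtype.val h)]
  · rw [hs a, hs b]
    exact GoodSeq.add_mono (GoodSeq.le_cancel_of_isCancelSet hL (S := {x : L | xᶜᶜ = x})
      one_compl_compl (isCancelSet_regular hL) (RegularSeq.ofGoodSeq hL a).2 (RegularSeq.ofGoodSeq hL b).2
      (RegularSeq.ofGoodSeq hL k).2 h) le_rfl

theorem isOGroup_of_chain (hL : IsBLChain L) : ChangGroup.IsOGroup L := by
  by_cases h : ∃ e : L, e ≠ 0 ∧ eᶜ ≠ 0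
  · obtain ⟨e, he0, he⟩ := h
    let _ := RegularSeq.addCommMonoid hL
    have := RegularSeq.isOrderedAddMonoid hL
    exact (isReflecting_ofGoodSeq hL he0 he).isOGroup fun _ _ => GoodSeq.total hL _ _
  · have hd : ∀ x : L, x ≠ 0 → xᶜ = 0 := fun x hx => not_not.1 fun h' => h ⟨x, hx, h'⟩
    exact GoodSeq.isOGroup_of_assoc hL fun a b c =>
      GoodSeq.assoc_of_isAssocSet hL (isAssocSet_dense hL hd) (fun _ => Set.mem_univ _)
        (fun _ => Set.mem_univ _) fun _ => Set.mem_univ _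

end BLAlgebra

/-! ### Cancellative type -/

namespace IsCancellativeChain

variable {C : Type w} [BLAlgebra C]

theorem isCancelSet_univ (hC : IsCancellativeChain C) : IsCancelSet (Set.univ : Set C) := by
  intro x _ y _ z _ hadd hmul
  refine hC.2 z x y ?_ ?_
  · rw [add_comm z, hadd, add_comm]
  · rw [mul_comm z, hmul, mul_comm]

/-- A non-regular `d` excludes any `x` with `x ≠ 0` and `xᶜ ≠ 0`: such an `x` cannot tell `d` from
`1` by sums or products, so cancellation would give `d = 1`, which is regular. -/
theorem isAssocSet_univ (hC : IsCancellativeChain C) : IsAssocSet (Set.univ : Set C) := by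
  by_cases hreg : ∀ x : C, xᶜᶜ = x
  · rw [← Set.eq_univ_of_forall (s := {x : C | xᶜᶜ = x}) hreg]
    exact isAssocSet_regular hC.1
  · rw [not_forall] at hreg
    obtain ⟨d, hd⟩ := hreg
    have hd0 := (regular_or_dense hC.1 d).resolve_left hd
    refine isAssocSet_dense hC.1 fun x hx0 => not_not.1 fun hx => hd ?_
    have hxr := (regular_or_dense hC.1 x).resolve_right hx
    have hd1 : d = 1 := hC.2 x d 1
      (by rw [badd_one, add_comm, dense_add hC.1 hd0 hx0])
      (by rw [mul_one, mul_comm, dense_mul_regular hC.1 hd0 hxr hx])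
    rw [hd1, one_compl_compl]

end IsCancellativeChain

namespace IsOfCancellativeType

variable {L : Type u} [BLAlgebra L]

theorem assoc (h : IsOfCancellativeType.{u, v, w} L) (a b c : GoodSeq L) :
    a + b + c = a + (b + c) := by
  obtain ⟨I, C, _, π, hC, -, hinj⟩ := h
  refine Subtype.ext (funext fun i => hinj _ _ fun j => ?_)
  have h1 := GoodSeq.assoc_of_isAssocSet (hC j).1 (hC j).isAssocSet_univ (a := a.map (π j))
    (b := b.map (π j)) (c := c.map (π j)) (fun _ => Set.mem_univ _) (fun _ => Set.mem_univ _)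
    (fun _ => Set.mem_univ _)
  rw [← GoodSeq.map_add, ← GoodSeq.map_add, ← GoodSeq.map_add, ← GoodSeq.map_add] at h1
  exact congrFun (congrArg Subtype.val h1) i

theorem le_cancel (h : IsOfCancellativeType.{u, v, w} L) {a b c : GoodSeq L}
    (hle : a + c ≤ b + c) : a ≤ b := by
  obtain ⟨I, C, _, π, hC, -, hinj⟩ := h
  intro i
  -- The inequality `a i ≤ b i` is the equation `a i ⇨ b i = 1`, so it can be tested in the factors.
  refine hinj _ _ fun j => ?_
  have h1 := GoodSeq.map_mono (π j) hle
  rw [GoodSeq.map_add, GoodSeq.map_add] at h1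
  have h2 := GoodSeq.le_cancel_of_isCancelSet (hC j).1 (Set.mem_univ _) (hC j).isCancelSet_univ
    (fun _ => Set.mem_univ _) (fun _ => Set.mem_univ _) (fun _ => Set.mem_univ _) h1
  rw [(π j).map_himp', (π j).map_one']
  exact h2 i

/-- Comparing the classes `[(x), (0)]` and `[(y), (0)]` and cancelling the witness leaves `(x) ≤
(y)`, whose leading term compares `x` with `y`. -/
theorem isBLChain_of_isOGroup (h : IsOfCancellativeType.{u, v, w} L)
    (hG : ChangGroup.IsOGroup L) : IsBLChain L := by
  obtain ⟨-, _, _, hs, -, htot⟩ := hG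
  have key : ∀ x y : L, ChangGroup.mk (GoodSeq.single x) 0 ≤ ChangGroup.mk (GoodSeq.single y) 0 →
      x ≤ y := by
    intro x y hxy
    obtain ⟨k, hk⟩ := (hs.mk_le_mk _ _ _ _).1 hxy
    have hle := h.le_cancel hk
    rw [GoodSeq.badd_zero, GoodSeq.zero_badd] at hle
    have h0 : stair 0 x 0 ≤ stair 0 y 0 := hle 0
    rwa [stair_self, stair_self] at h0
  exact fun x y => (htot _ _).imp (key x y) (key y x)

end IsOfCancellativeType

theorem lemma6p3 (L : Type u) [BLAlgebra L] :
    (IsBLChain L → ChangGroup.IsOGroup L) ∧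
      (IsOfCancellativeType.{u, v, w} L →
        ChangGroup.IsPoGroup L ∧ (ChangGroup.IsOGroup L → IsBLChain L)) :=
  ⟨isOGroup_of_chain, fun h => ⟨GoodSeq.isPoGroup_of_assoc h.assoc, h.isBLChain_of_isOGroup⟩⟩
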